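/- Let $d\ge 2$ and let $L(\mathbb C^d)$ be the linear maps on $\mathbb C^d$, with the operator norm. Let $\mu$ be a Borel measure on $L(\mathbb C^d)$ such that $$\int \|v\|^2\,d\mu(v)<\infty,\qquad \int v^*v\,d\mu(v)=\mathrm{Id},$$ and assume that $\mu$ is irreducible: if a linear subspace $E\subset\mathbb C^d$ satisfies $vE\subset E$ for $\mu$-almost every $v$, then $E=\{0\}$ or $E=\mathbb C^d$. A non-zero subspace $D\subset\mathbb C^d$ is *dark* if for every $n\ge1$ and $\mu^{\otimes n}$-almost every $(v_1,\dots,v_n)$ there are $c\ge0$ and a unitary $U$ such that $v_n\cdots v_1x=c\,Ux$ for all $x\in D$. Let $\mathcal D_m$ be the set of dark subspaces of maximal dimension, and let $\pi_D$ be the orthogonal projector onto $D$. Let $\mathcal M$ be the set of density matrices on $\mathbb C^d$ (that is, $\rho\ge0$ and $\operatorname{tr}\rho=1$). For a Borel probability measure $\nu$ on $\mathcal M$, let $\mathbb P_\nu$ be the probability measure on $\mathcal M\times L(\mathbb C^d)^{\{1,2,\dots\}}$ under which $\rho_0$ (the first component) has law $\nu$ and, given $\rho_0,v_1,\dots,v_n$,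 the next map $v_{n+1}$ has law $\operatorname{tr}(v\rho_nv^*)\,d\mu(v)$, where $$\rho_n=\frac{W_n\rho_0W_n^*}{\operatorname{tr}(W_n\rho_0W_n^*)},\qquad W_n=v_n\cdots v_1,\quad W_0=\mathrm{Id}$$ ($\rho_n$ is well defined $\mathbb P_\nu$-almost surely). Let $\mathbb E_\nu$ be the expectation with respect to $\mathbb P_\nu$. **Theorem.** There exist constants $C>0$ and $0<\lambda<1$ (depending only on $\mu$) such that for every Borel probability measure $\nu$ on $\mathcal M$ and every integer $n\ge0$, the random variable $\inf_{D\in\mathcal D_m}\bigl(1-\operatorname{tr}(\pi_D\rho_n)\bigr)$ is $\mathbb P_\nu$-integrable and $$\mathbb E_\nu\Bigl[\inf_{D\in\mathcal D_m}\bigl(1-\operatorname{tr}(\pi_D\rho_n)\bigr)\Bigr]\le C\lambda^n .$$ -/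

import Mathlib

open MeasureTheory ProbabilityTheory

/-- The Hilbert space `ℂ^d`. -/
abbrev Hilb (d : ℕ) : Type := EuclideanSpace ℂ (Fin d)

/-- The linear maps on `ℂ^d`, with the operator norm and its Borel sets. -/
abbrev Op (d : ℕ) : Type := Hilb d →L[ℂ] Hilb d

/-- The trace of a linear map on `ℂ^d`. -/
noncomputable def opTrace {d : ℕ} (a : Op d) : ℂ :=
  LinearMap.trace ℂ (Hilb d) (a : Hilb d →ₗ[ℂ] Hilb d)

/-- Density matrices: positive semidefinite operators of trace one. -/
abbrev DensityMatrix (d : ℕ) : Type := {ρ : Op d // ρ.IsPositive ∧ opTrace ρ = 1}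

/-- The standing assumptions on `μ`: finite second moment, and `∫ v* v dμ(v) = Id`. -/
structure IsStochastic {d : ℕ} (μ : Measure (Op d)) : Prop where
  moment : ∫⁻ v, ‖v‖ₑ ^ 2 ∂μ < ⊤
  integral_eq : ∫ v, star v * v ∂μ = 1

/-- `μ` is irreducible: the only subspaces that are invariant under `μ`-almost every `v`
are `{0}` and the whole space. -/
def IsIrreducibleMeasure {d : ℕ} (μ : Measure (Op d)) : Prop :=
  ∀ E : Submodule ℂ (Hilb d), (∀ᵐ v ∂μ, ∀ x ∈ E, v x ∈ E) → E = ⊥ ∨ E = ⊤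

/-- The product `vₙ ⋯ v₁` of the first `n` entries of a sequence
(`v i` is the factor number `i + 1`). -/
noncomputable def prodOp {d : ℕ} : (n : ℕ) → (Fin n → Op d) → Op d
  | 0, _ => 1
  | n + 1, v => v (Fin.last n) * prodOp n (fun i => v i.castSucc)

/-- Dark subspaces: for every `n ≥ 1`, almost every product of `n` operators restricts to `D` as
a nonnegative multiple of the restriction of a unitary. -/
def IsDark {d : ℕ} (μ : Measure (Op d)) (D : Submodule ℂ (Hilb d)) : Prop :=
  D ≠ ⊥ ∧ ∀ n : ℕ, 1 ≤ n → ∀ᵐ v ∂(Measure.pi fun _ : Fin n => μ),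
    ∃ c : ℝ, 0 ≤ c ∧ ∃ U ∈ unitary (Op d), ∀ x ∈ D, prodOp n v x = (c : ℂ) • U x

/-- The set of dark subspaces of maximal dimension. -/
def maximalDark {d : ℕ} (μ : Measure (Op d)) : Set (Submodule ℂ (Hilb d)) :=
  {D | IsDark μ D ∧
    ∀ D', IsDark μ D' → Module.finrank ℂ D' ≤ Module.finrank ℂ D}

section TraceFacts

variable {d : ℕ}

lemma continuous_opTrace : Continuous (opTrace : Op d → ℂ) :=
  LinearMap.continuous_of_finiteDimensional
    ((LinearMap.trace ℂ (Hilb d)).comp (ContinuousLinearMap.coeLM ℂ))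

lemma continuous_star_op : Continuous (fun v : Op d => star v) :=
  (ContinuousLinearMap.adjoint : Op d ≃ₗᵢ⋆[ℂ] Op d).continuous

lemma norm_star_mul_self_op (v : Op d) : ‖star v * v‖ = ‖v‖ * ‖v‖ :=
  ContinuousLinearMap.norm_adjoint_comp_self v

lemma opTrace_mul_comm (a b : Op d) : opTrace (a * b) = opTrace (b * a) :=
  LinearMap.trace_mul_comm ℂ (a : Hilb d →ₗ[ℂ] Hilb d) (b : Hilb d →ₗ[ℂ] Hilb d)

lemma isPositive_conj (v : Op d) {ρ : Op d} (h : ρ.IsPositive) :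
    (v * ρ * star v).IsPositive := by
  have := h.conj_adjoint v
  rwa [← ContinuousLinearMap.comp_assoc] at this

open scoped ComplexOrder in
lemma opTrace_nonneg {a : Op d} (h : a.IsPositive) : 0 ≤ opTrace a :=
  LinearMap.IsPositive.trace_nonneg h.toLinearMap

end TraceFacts

open scoped ComplexOrder in
/-- The state after the measurement outcome `v`: `v ρ v* / tr (v ρ v*)`. The outcomes with
`tr (v ρ v*) = 0`, for which it is set to `ρ`, have probability zero. -/
noncomputable def updateState {d : ℕ} (ρ : DensityMatrix d) (v : Op d) : DensityMatrix d :=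
  open Classical in
  if h : opTrace (v * ρ.1 * star v) = 0 then ρ
  else ⟨(opTrace (v * ρ.1 * star v))⁻¹ • (v * ρ.1 * star v), by
    refine ⟨ContinuousLinearMap.IsPositive.smul_of_nonneg (isPositive_conj v ρ.2.1)
      (inv_nonneg.2 (opTrace_nonneg (isPositive_conj v ρ.2.1))), ?_⟩
    have e : ∀ (c : ℂ) (a : Op d), opTrace (c • a) = c * opTrace a := fun c a => by
      simp [opTrace]
    rw [e, inv_mul_cancel₀ h]⟩

/-- The law `tr (v ρ v*) dμ(v)` of the next outcome in the state `ρ`. -/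
noncomputable def outcomeStep {d : ℕ} (μ : Measure (Op d)) (ρ : DensityMatrix d) :
    Measure (Op d) :=
  μ.withDensity fun v => ENNReal.ofReal (opTrace (v * ρ.1 * star v)).re

section StepFacts

variable {d : ℕ} {μ : Measure (Op d)}

lemma IsStochastic.integrable (hμ : IsStochastic μ) :
    Integrable (fun v : Op d => star v * v) μ := by
  refine ⟨(continuous_star_op.mul continuous_id : Continuous fun v : Op d => star v * v).aestronglyMeasurable, ?_⟩
  refine lt_of_le_of_lt (le_of_eq (lintegral_congr fun v => ?_)) hμ.moment
  change ‖star v * v‖ₑ = ‖v‖ₑ ^ 2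
  rw [← ofReal_norm, ← ofReal_norm, norm_star_mul_self_op,
    ENNReal.ofReal_mul (norm_nonneg _), sq]

open scoped ComplexOrder in
lemma outcomeStep_apply (hμ : IsStochastic μ) (ρ : DensityMatrix d) {B : Set (Op d)}
    (hB : MeasurableSet B) :
    outcomeStep μ ρ B
      = ENNReal.ofReal (opTrace (ρ.1 * ∫ v in B, star v * v ∂μ)).re := by
  let T : Op d →L[ℝ] ℝ :=
    Complex.reCLM.comp ((LinearMap.toContinuousLinearMap
      (((LinearMap.trace ℂ (Hilb d)).comp (ContinuousLinearMap.coeLM ℂ)).comp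
        (LinearMap.mulLeft ℂ ρ.1))).restrictScalars ℝ)
  have hT : ∀ a, T a = (opTrace (ρ.1 * a)).re := fun a => rfl
  have hv : ∀ v : Op d, T (star v * v) = (opTrace (v * ρ.1 * star v)).re := fun v => by
    rw [hT, mul_assoc, opTrace_mul_comm v, mul_assoc]
  rw [outcomeStep, withDensity_apply _ hB, ← hT, ← T.integral_comp_comm hμ.integrable.integrableOn,
    ofReal_integral_eq_lintegral_ofReal (T.integrable_comp hμ.integrable.integrableOn)]
  · simp_rw [hv]
  · refine Filter.Eventually.of_forall fun v => ?_
    change 0 ≤ T (star v * v)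
    rw [hv]
    exact (Complex.le_def.1 (opTrace_nonneg (isPositive_conj v ρ.2.1))).1

lemma measurable_outcomeStep (hμ : IsStochastic μ) :
    Measurable (outcomeStep μ : DensityMatrix d → Measure (Op d)) := by
  refine Measure.measurable_of_measurable_coe _ fun B hB => ?_
  simp_rw [outcomeStep_apply hμ _ hB]
  have : Continuous fun ρ : DensityMatrix d =>
      (opTrace (ρ.1 * ∫ v in B, star v * v ∂μ)).re :=
    Complex.continuous_re.comp (continuous_opTrace.comp (by fun_prop))
  exact ENNReal.measurable_ofReal.comp this.measurable

lemma outcomeStep_univ (hμ : IsStochastic μ) (ρ : DensityMatrix d) :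
    outcomeStep μ ρ Set.univ = 1 := by
  rw [outcomeStep_apply hμ ρ MeasurableSet.univ, Measure.restrict_univ, hμ.integral_eq,
    mul_one, ρ.2.2]
  simp

lemma measurable_updateState :
    Measurable fun p : DensityMatrix d × Op d => updateState p.1 p.2 := by
  have hc : Continuous fun p : DensityMatrix d × Op d => p.2 * p.1.1 * star p.2 :=
    (continuous_snd.mul (continuous_subtype_val.comp continuous_fst)).mul
      (continuous_star_op.comp continuous_snd)
  have ht := continuous_opTrace.comp hc
  refine Measurable.subtype_mk (f := fun p : DensityMatrix d × Op d => (updateState p.1 p.2).1)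
    (h := fun p => (updateState p.1 p.2).2) ?_
  have : (fun p : DensityMatrix d × Op d => (updateState p.1 p.2).1) = fun p =>
      open Classical in
      if opTrace (p.2 * p.1.1 * star p.2) = 0 then p.1.1
      else (opTrace (p.2 * p.1.1 * star p.2))⁻¹ • (p.2 * p.1.1 * star p.2) := by
    funext p
    unfold updateState
    split_ifs <;> rfl
  rw [this]
  refine Measurable.ite (ht.measurable (measurableSet_singleton 0)) (by fun_prop) ?_
  exact ht.measurable.inv.smul hc.measurable

end StepFacts

/-- One step of the dynamics: from the state `ρ`, draw `v` with law `tr (v ρ v*) dμ(v)`;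
the new pair is (updated state, outcome `v`). -/
noncomputable def stepKernel {d : ℕ} {μ : Measure (Op d)} (hμ : IsStochastic μ) :
    Kernel (DensityMatrix d) (DensityMatrix d × Op d) :=
  (Kernel.id ×ₖ (⟨outcomeStep μ, measurable_outcomeStep hμ⟩ : Kernel (DensityMatrix d) (Op d))).map
    fun p => (updateState p.1 p.2, p.2)

instance {d : ℕ} {μ : Measure (Op d)} (hμ : IsStochastic μ) :
    IsMarkovKernel (stepKernel hμ) := by
  have : IsMarkovKernel
      (⟨outcomeStep μ, measurable_outcomeStep hμ⟩ : Kernel (DensityMatrix d) (Op d)) :=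
    ⟨fun ρ => ⟨outcomeStep_univ hμ ρ⟩⟩
  exact Kernel.IsMarkovKernel.map _ (measurable_updateState.prodMk measurable_snd)

/-- The law `ℙ^ρ` on `Ω = (Op d)^ℕ` of the sequence of outcomes (the outcome number `i + 1` being
`ω i`) from the initial state `ρ`: the next outcome has law `tr (v ρₙ v*) dμ(v)`, where `ρₙ` is the
current state. It is obtained by running the chain of pairs (state, last outcome) from `(ρ, 0)`,
where `0` is a placeholder that plays no role, and recording the outcomes. -/
noncomputable def outcomeLaw {d : ℕ} {μ : Measure (Op d)} (hμ : IsStochastic μ) :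
    Kernel (DensityMatrix d) (ℕ → Op d) :=
  ((Kernel.traj (X := fun _ => DensityMatrix d × Op d)
      (fun n => (stepKernel hμ).comap
        (fun h : (i : Finset.Iic n) → DensityMatrix d × Op d =>
          (h ⟨n, Finset.mem_Iic.2 le_rfl⟩).1) (by fun_prop)) 0).comap
    (fun ρ _ => (ρ, 0)) (by fun_prop)).map (fun x i => (x (i + 1)).2)

/-- The law `ℙ_ν` on `DensityMatrix d × Ω`: `ℙ_ν (B × O) = ∫_B ℙ^ρ(O) dν(ρ)`. -/
noncomputable def trajectoryLaw {d : ℕ} {μ : Measure (Op d)} (hμ : IsStochastic μ)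
    (ν : Measure (DensityMatrix d)) : Measure (DensityMatrix d × (ℕ → Op d)) :=
  ν ⊗ₘ outcomeLaw hμ

/-- The quantum trajectory `ρₙ = Wₙ ρ₀ Wₙ* / tr (Wₙ ρ₀ Wₙ*)`, with `Wₙ = vₙ ⋯ v₁`. -/
noncomputable def quantumTrajectory {d : ℕ} (n : ℕ) (p : DensityMatrix d × (ℕ → Op d)) : Op d :=
  let W : Op d := prodOp n fun i => p.2 i
  (opTrace (W * p.1.1 * star W))⁻¹ • (W * p.1.1 * star W)

/-- `inf_{D ∈ 𝒟ₘ} (1 - tr (π_D ρ))`. -/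
noncomputable def darkDefect {d : ℕ} (μ : Measure (Op d)) (ρ : Op d) : ℝ :=
  ⨅ D : maximalDark μ, (1 - (opTrace (D.1.starProjection * ρ)).re)

/-!
Write `Wₙ = vₙ ⋯ v₁` and `Q(ρ) = inf_D (1 - tr (π_D ρ))`. The proof shows that, for some `n`, the
function `√Q` is contracted by the `n`-step Markov operator of the state: `E^ρ[√Q(ρₙ)] ≤ λ √Q(ρ)` for
every `ρ`, with `λ < 1` (`IsMaximalDarkDim.exists_contraction`). Since `Q ≤ √Q ≤ 1`, this gives the
theorem.

*Comparison with the image of a dark subspace.* Let `D` be a maximal dark subspace with projection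
`P`, and `c = ‖W P‖` the factor by which `W = Wₙ` stretches `D`. When `c ≠ 0`, the image `W D` is again
maximal dark, so that the new state has defect at most its mass outside `W D`. Decomposing the
vectors of an ensemble of `ρ` along `D` and `Dᗮ`, with `s² = 1 - tr (P ρ)`, and applying the
Cauchy-Schwarz inequality, one finds `E^ρ[√Q(ρₙ)] ≤ d κₙ s + s²`, where `κₙ` is the supremum over `D`
and over unit vectors `e ⟂ D` of `∫ c ‖(1 - π_{WD}) W e‖ dμ^{⊗ n}`
(`IsMaximalDarkDim.evolve_rootDefect_le`). The square root is essential: `Q` itself need not decrease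
on average near the dark subspaces.

*Decay of `κₙ`.* The integrand is multiplicative along products (`angleDefect_mul`), so `κₙ` is
submultiplicative, and `κₙ ≤ 1` by the Cauchy-Schwarz inequality and `∫ ‖W x‖² dμ^{⊗ n} = ‖x‖²`.
Equality for a pair `(D, e)` and all `n` would force `‖W e‖ = c` and `W e ⟂ W D` almost surely, so that
`D ⊕ ℂ e` would be dark, against the maximality of `D` (`add_rankOne_mem_darkProjections`). As the set
of pairs is compact and the integrals are continuous in the pair, `κₙ < 1` for some `n`, hence
`κₙ → 0` (`exists_forall_meanDefect_le`).

*Irreducibility.* The vectors that almost surely never acquire a component in `D` form an invariant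
subspace, which is therefore zero; by compactness, from every state the mean overlap with `D` is at
least some `η > 0` within a bounded number of steps (`exists_evolve_overlap_ge`). Applying the estimate
above from that step on gives `E^ρ[√Q(ρₙ)] ≤ 1 - η / 2` for all `ρ` and all large `n`. Combined with
`E^ρ[√Q(ρₙ)] ≤ d κₙ √Q(ρ) + Q(ρ)`, which is the estimate for an optimal `D`, this yields the
contraction.

Two technical points. The measure `μ` may have an atom of infinite mass at `0`, in which case it is
not σ-finite; as `v = 0` has probability zero and is harmless for darkness, `μ` is replaced by its
restriction to `{0}ᶜ` (`nonzeroPart`). And all the integrals over `μ^{⊗ n}` depend on the outcomes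
through `Wₙ` only, so they are taken against the law of `Wₙ`, a multiplicative convolution power
(`productLaw`).
-/

open scoped ENNReal

/-! ### Reduction to a σ-finite measure, and the law of the products -/

section PiRestrict

variable {ι : Type*} [Fintype ι] {α : ι → Type*} [∀ i, MeasurableSpace (α i)]

lemma pi_apply_eq_outerMeasure_pi (μ : ∀ i, Measure (α i)) {s : Set (∀ i, α i)}
    (hs : MeasurableSet s) :
    Measure.pi μ s = OuterMeasure.pi (fun i => (μ i).toOuterMeasure) s := by
  rw [Measure.pi, toMeasure_apply _ _ hs]

/-- Unlike `Measure.restrict_pi_pi`, this needs no σ-finiteness, which may fail here because of an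
atom of infinite mass at `0`. -/
lemma restrict_pi_pi_le (μ : ∀ i, Measure (α i)) {s : ∀ i, Set (α i)}
    (hs : ∀ i, MeasurableSet (s i)) :
    (Measure.pi μ).restrict (Set.univ.pi s) ≤ Measure.pi fun i => (μ i).restrict (s i) := by
  have hm : MeasurableSet (Set.univ.pi s) := MeasurableSet.univ_pi hs
  have key : OuterMeasure.restrict (Set.univ.pi s)
        (OuterMeasure.pi fun i => (μ i).toOuterMeasure) ≤
      OuterMeasure.pi fun i => ((μ i).restrict (s i)).toOuterMeasure := by
    rw [OuterMeasure.le_pi]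
    intro t _
    rw [OuterMeasure.restrict_apply, ← Set.pi_inter_distrib]
    refine (OuterMeasure.pi_pi_le _ _).trans (Finset.prod_le_prod' fun i _ => ?_)
    exact (Measure.restrict_apply' (hs i)).ge
  refine Measure.le_iff.2 fun t ht => ?_
  rw [Measure.restrict_apply ht, pi_apply_eq_outerMeasure_pi _ (ht.inter hm),
    pi_apply_eq_outerMeasure_pi _ ht]
  simpa [OuterMeasure.restrict_apply] using key t

lemma pi_mono_measure {μ ν : ∀ i, Measure (α i)} (h : ∀ i, μ i ≤ ν i) :
    Measure.pi μ ≤ Measure.pi ν := by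
  refine Measure.le_iff.2 fun t ht => ?_
  rw [pi_apply_eq_outerMeasure_pi _ ht, pi_apply_eq_outerMeasure_pi _ ht]
  have : OuterMeasure.pi (fun i => (μ i).toOuterMeasure) ≤
      OuterMeasure.pi fun i => (ν i).toOuterMeasure := by
    rw [OuterMeasure.le_pi]
    intro t _
    exact (OuterMeasure.pi_pi_le _ _).trans (Finset.prod_le_prod' fun i _ => h i _)
  exact this t

end PiRestrict

section NonzeroPart

variable {d : ℕ}

/-- The part of `μ` carried by the nonzero maps. Unlike `μ`, it is always σ-finite, and it defines
the same outcome laws. -/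
noncomputable def nonzeroPart (μ : Measure (Op d)) : Measure (Op d) := μ.restrict {0}ᶜ

variable {μ : Measure (Op d)}

lemma lintegral_nonzeroPart {f : Op d → ℝ≥0∞} (h0 : f 0 = 0) :
    ∫⁻ v, f v ∂(nonzeroPart μ) = ∫⁻ v, f v ∂μ := by
  have h := setLIntegral_eq_of_support_subset (μ := μ) (s := {0}ᶜ) (f := f) ?_
  · exact h
  · intro v hv hv0
    exact hv (by rw [hv0, h0])

lemma ae_of_ae_nonzeroPart {p : Op d → Prop} (h0 : p 0) (h : ∀ᵐ v ∂(nonzeroPart μ), p v) :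
    ∀ᵐ v ∂μ, p v := by
  rw [nonzeroPart, ae_restrict_iff' (measurableSet_singleton 0).compl] at h
  filter_upwards [h] with v hv
  by_cases hv0 : v = 0
  · rwa [hv0]
  · exact hv hv0

lemma sigmaFinite_nonzeroPart (hμ : IsStochastic μ) : SigmaFinite (nonzeroPart μ) := by
  obtain ⟨t, -, ht0, ht⟩ := (ENNReal.finStronglyMeasurable_of_measurable
    (f := fun v : Op d => ‖v‖ₑ ^ 2) hμ.moment.ne (by fun_prop)).exists_set_sigmaFinite
  have hsub : ({0}ᶜ : Set (Op d)) ⊆ t := fun v hv => by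
    by_contra hvt
    have h := (pow_eq_zero_iff two_ne_zero).1 (ht0 v hvt)
    rw [← ofReal_norm, ENNReal.ofReal_eq_zero, norm_le_zero_iff] at h
    exact hv h
  have := Restrict.sigmaFinite (μ.restrict t) ({0}ᶜ : Set (Op d))
  rwa [Measure.restrict_restrict (measurableSet_singleton 0).compl,
    Set.inter_eq_left.2 hsub] at this

lemma lintegral_enorm_sq_apply_nonzeroPart (hμ : IsStochastic μ) (x : Hilb d) :
    ∫⁻ v, ‖v x‖ₑ ^ 2 ∂(nonzeroPart μ) = ‖x‖ₑ ^ 2 := by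
  rw [lintegral_nonzeroPart (by simp)]
  let T : Op d →L[ℝ] ℝ := Complex.reCLM.comp
    (((innerSL ℂ x).comp (ContinuousLinearMap.apply ℂ (Hilb d) x)).restrictScalars ℝ)
  have hT : ∀ v : Op d, T (star v * v) = ‖v x‖ ^ 2 := fun v => by
    change (inner ℂ x ((star v * v) x)).re = _
    rw [ContinuousLinearMap.star_eq_adjoint, mul_apply_eq_comp,
      ContinuousLinearMap.adjoint_inner_right]
    exact (norm_sq_eq_re_inner (𝕜 := ℂ) (v x)).symm
  have h1 : ∫ v, ‖v x‖ ^ 2 ∂μ = ‖x‖ ^ 2 := by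
    simp_rw [← hT]
    rw [T.integral_comp_comm hμ.integrable, hμ.integral_eq]
    change (inner ℂ x x).re = _
    exact (norm_sq_eq_re_inner (𝕜 := ℂ) x).symm
  have hi : Integrable (fun v : Op d => ‖v x‖ ^ 2) μ := by
    simp_rw [← hT]
    exact T.integrable_comp hμ.integrable
  have h2 := ofReal_integral_eq_lintegral_ofReal hi (Filter.Eventually.of_forall fun v => by positivity)
  rw [h1] at h2
  simpa [ENNReal.ofReal_pow] using h2.symm

end NonzeroPart

section ProductLaw

variable {d : ℕ}

/-- The law of `Wₙ = vₙ ⋯ v₁` when `(v₁, …, vₙ)` is drawn from `m^{⊗ n}`. -/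
noncomputable def productLaw (m : Measure (Op d)) : ℕ → Measure (Op d)
  | 0 => Measure.dirac 1
  | n + 1 => Measure.mconv m (productLaw m n)

variable {m : Measure (Op d)}

instance sFinite_productLaw [SFinite m] (n : ℕ) : SFinite (productLaw m n) := by
  induction n with
  | zero => rw [productLaw]; infer_instance
  | succ n ih => rw [productLaw, Measure.mconv]; infer_instance

lemma productLaw_one [SFinite m] : productLaw m 1 = m := by
  simp [productLaw]

lemma productLaw_add [SFinite m] (a b : ℕ) :
    productLaw m (a + b) = Measure.mconv (productLaw m a) (productLaw m b) := by
  induction a with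
  | zero => simp [productLaw]
  | succ a ih =>
    rw [Nat.add_right_comm, productLaw, ih, productLaw, Measure.mconv_assoc]

lemma lintegral_productLaw_add [SFinite m] (a b : ℕ) {f : Op d → ℝ≥0∞} (hf : Measurable f) :
    ∫⁻ W, f W ∂(productLaw m (a + b)) =
      ∫⁻ W₁, ∫⁻ W₂, f (W₂ * W₁) ∂(productLaw m a) ∂(productLaw m b) := by
  rw [productLaw_add, Measure.lintegral_mconv hf, lintegral_lintegral_swap]
  exact (hf.comp (by fun_prop : Measurable fun p : Op d × Op d => p.1 * p.2)).aemeasurable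

lemma ae_productLaw_add [SFinite m] (a b : ℕ) {p : Op d → Prop} (hp : MeasurableSet {W | p W}) :
    (∀ᵐ W ∂(productLaw m (a + b)), p W) ↔
      ∀ᵐ W₁ ∂(productLaw m b), ∀ᵐ W₂ ∂(productLaw m a), p (W₂ * W₁) := by
  have hind : Measurable ({W | ¬ p W}.indicator (1 : Op d → ℝ≥0∞)) :=
    measurable_one.indicator hp.compl
  have key : ∀ (q : Measure (Op d)) (r : Op d → Op d), Measurable r →
      ((∀ᵐ W ∂q, p (r W)) ↔ ∫⁻ W, {W | ¬ p W}.indicator (1 : Op d → ℝ≥0∞) (r W) ∂q = 0) := by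
    intro q r hr
    refine Iff.trans ?_ (lintegral_eq_zero_iff (hind.comp hr)).symm
    refine Filter.eventually_congr (Filter.Eventually.of_forall fun W => ?_)
    simp
  refine (key _ id measurable_id).trans ?_
  simp only [id]
  rw [lintegral_productLaw_add a b hind, lintegral_eq_zero_iff]
  · refine Filter.eventually_congr (Filter.Eventually.of_forall fun W => ?_)
    exact (key _ (fun W₂ => W₂ * W) (by fun_prop)).symm
  · exact Measurable.lintegral_prod_right'
      (f := fun q : Op d × Op d => {W | ¬ p W}.indicator (1 : Op d → ℝ≥0∞) (q.2 * q.1))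
      (hind.comp (by fun_prop))

lemma continuous_prodOp (n : ℕ) : Continuous (prodOp n : (Fin n → Op d) → Op d) := by
  induction n with
  | zero => exact continuous_const
  | succ n ih =>
    exact (continuous_apply _).mul (ih.comp (by fun_prop))

lemma map_prodOp_pi [SigmaFinite m] (n : ℕ) :
    (Measure.pi fun _ : Fin n => m).map (prodOp n) = productLaw m n := by
  induction n with
  | zero =>
    rw [Measure.pi_of_empty _ 0, Measure.map_dirac' (continuous_prodOp 0).measurable]
    rfl
  | succ n ih =>
    have hp := measurePreserving_piFinSuccAbove (fun _ : Fin (n + 1) => m) (Fin.last n)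
    rw [productLaw, ← ih, Measure.mconv]
    have hd := Measure.map_prod_map m (Measure.pi fun _ : Fin n => m) measurable_id
      (continuous_prodOp n).measurable
    rw [Measure.map_id] at hd
    rw [hd, Measure.map_map (by fun_prop)
      (measurable_id.prodMap (continuous_prodOp n).measurable), ← hp.map_eq,
      Measure.map_map _ hp.measurable]
    · congr 1
      funext v
      simp [prodOp, MeasurableEquiv.piFinSuccAbove, Fin.insertNthEquiv, Fin.init_def]
    · have := (continuous_prodOp (d := d) n).measurable
      fun_prop

lemma lintegral_enorm_sq_apply_productLaw [SFinite m]
    (hm : ∀ x : Hilb d, ∫⁻ v, ‖v x‖ₑ ^ 2 ∂m = ‖x‖ₑ ^ 2) (n : ℕ) (x : Hilb d) :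
    ∫⁻ W, ‖W x‖ₑ ^ 2 ∂(productLaw m n) = ‖x‖ₑ ^ 2 := by
  induction n with
  | zero => simp [productLaw, lintegral_dirac]
  | succ n ih =>
    rw [add_comm, lintegral_productLaw_add 1 n (by fun_prop), productLaw_one]
    simp_rw [mul_apply_eq_comp, hm]
    exact ih

/-- Almost sure statements on `(v₁, …, vₙ)` can be read on the σ-finite part of `μ`, as long as they
only concern the product `Wₙ` and hold when it vanishes. -/
lemma ae_pi_prodOp_iff {μ : Measure (Op d)} [SigmaFinite (nonzeroPart μ)] (n : ℕ)
    {p : Op d → Prop} (h0 : p 0) (hp : MeasurableSet {W | p W}) :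
    (∀ᵐ v ∂(Measure.pi fun _ : Fin n => μ), p (prodOp n v)) ↔
      ∀ᵐ W ∂(productLaw (nonzeroPart μ) n), p W := by
  rw [← map_prodOp_pi, ae_map_iff (continuous_prodOp n).measurable.aemeasurable hp]
  have hzero : ∀ (n : ℕ) (v : Fin n → Op d) (i : Fin n), v i = 0 → prodOp n v = 0 := by
    intro n
    induction n with
    | zero => exact fun v i => i.elim0
    | succ n ih =>
      intro v i hi
      rw [prodOp]
      induction i using Fin.lastCases with
      | last => rw [hi, zero_mul]
      | cast i => rw [ih _ i hi, mul_zero]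
  constructor
  · exact fun h => (Measure.absolutelyContinuous_of_le
      (pi_mono_measure fun _ => Measure.restrict_le_self)).ae_le h
  · intro h
    have hs : MeasurableSet ({0}ᶜ : Set (Op d)) := (measurableSet_singleton 0).compl
    have : ∀ᵐ v ∂(Measure.pi fun _ : Fin n => μ).restrict (Set.univ.pi fun _ => {0}ᶜ),
        p (prodOp n v) := (Measure.absolutelyContinuous_of_le
      (restrict_pi_pi_le (fun _ : Fin n => μ) fun _ => hs)).ae_le h
    rw [ae_restrict_iff' (MeasurableSet.univ_pi fun _ => hs)] at this
    filter_upwards [this] with v hv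
    by_cases hall : ∀ i, v i ≠ 0
    · exact hv fun i _ => hall i
    · push Not at hall
      obtain ⟨i, hi⟩ := hall
      rwa [hzero n v i hi]

end ProductLaw

/-! ### Maps that are conformal on the range of a projection -/

section Conformal

variable {d : ℕ}

/-- For an orthogonal projection `P`, the map `W` restricts to a multiple of an isometry on the
range of `P`; the multiple is necessarily `‖W * P‖`. -/
def IsConformalOn (P W : Op d) : Prop :=
  star (W * P) * (W * P) = ((‖W * P‖ ^ 2 : ℝ) : ℂ) • P

/-- When `W` is conformal and nonzero on the range of `P`, the orthogonal projection onto the image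
of that range under `W`. It is `0` when `W * P = 0`. -/
noncomputable def imageProj (P W : Op d) : Op d :=
  ((‖W * P‖ ^ 2 : ℝ) : ℂ)⁻¹ • (W * P * star (W * P))

variable {P W V : Op d}

lemma norm_sq_eq_re_inner_star (A : Op d) (x : Hilb d) :
    ‖A x‖ ^ 2 = (inner ℂ x ((star A * A) x)).re := by
  rw [ContinuousLinearMap.star_eq_adjoint, mul_apply_eq_comp,
    ContinuousLinearMap.adjoint_inner_right]
  exact norm_sq_eq_re_inner (𝕜 := ℂ) (A x)

lemma IsStarProjection.norm_apply_sq (hP : IsStarProjection P) (x : Hilb d) :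
    ‖P x‖ ^ 2 = (inner ℂ x (P x)).re := by
  rw [norm_sq_eq_re_inner_star, hP.isSelfAdjoint.star_eq, hP.isIdempotentElem.eq]

lemma IsStarProjection.norm_sub_apply_sq (hP : IsStarProjection P) (x : Hilb d) :
    ‖(1 - P) x‖ ^ 2 = ‖x‖ ^ 2 - ‖P x‖ ^ 2 := by
  rw [hP.norm_apply_sq, hP.one_sub.norm_apply_sq, norm_sq_eq_re_inner (𝕜 := ℂ) x]
  simp

lemma IsConformalOn.norm_apply (h : IsConformalOn P W) {x : Hilb d} (hx : P x = x) :
    ‖W x‖ = ‖W * P‖ * ‖x‖ := by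
  have h1 := norm_sq_eq_re_inner_star (W * P) x
  rw [h, mul_apply_eq_comp, hx, smul_apply, hx, inner_smul_right,
    Complex.re_ofReal_mul] at h1
  have h2 := norm_sq_eq_re_inner (𝕜 := ℂ) x
  have h3 : ‖W x‖ ^ 2 = (‖W * P‖ * ‖x‖) ^ 2 := by
    rw [h1, mul_pow, h2]; rfl
  exact (pow_left_inj₀ (norm_nonneg _) (by positivity) two_ne_zero).1 h3

lemma isConformalOn_of_eq_smul (hP : IsStarProjection P) {t : ℝ} (ht : 0 ≤ t)
    (h : star (W * P) * (W * P) = (t : ℂ) • P) : IsConformalOn P W := by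
  by_cases h0 : P = 0
  · rw [IsConformalOn, h0, mul_zero, mul_zero]
    exact (smul_zero _).symm
  have h1 : ‖P‖ = 1 := by
    have h1 := norm_star_mul_self_op P
    rw [hP.isSelfAdjoint.star_eq, hP.isIdempotentElem.eq] at h1
    exact (mul_eq_left₀ (norm_ne_zero_iff.2 h0)).1 h1.symm
  have h2 : ‖W * P‖ ^ 2 = t := by
    rw [sq, ← norm_star_mul_self_op, h, norm_smul, h1, mul_one, Complex.norm_real,
      Real.norm_of_nonneg ht]
  rw [IsConformalOn, h, h2]

lemma mul_norm_sq_eq (hP : IsStarProjection P) (h : IsConformalOn P W) :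
    W * P * star (W * P) * (W * P) = ((‖W * P‖ ^ 2 : ℝ) : ℂ) • (W * P) := by
  rw [mul_assoc, h, mul_smul_comm, mul_assoc, hP.isIdempotentElem.eq]

lemma imageProj_mul (hP : IsStarProjection P) (h : IsConformalOn P W) (h0 : W * P ≠ 0) :
    imageProj P W * (W * P) = W * P := by
  have hc : ((‖W * P‖ ^ 2 : ℝ) : ℂ) ≠ 0 := by simpa using h0
  rw [imageProj, smul_mul_assoc, mul_norm_sq_eq hP h, inv_smul_smul₀ hc]

lemma isStarProjection_imageProj (hP : IsStarProjection P) (h : IsConformalOn P W)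
    (h0 : W * P ≠ 0) : IsStarProjection (imageProj P W) where
  isIdempotentElem := by
    have := imageProj_mul hP h h0
    rw [IsIdempotentElem]
    nth_rw 2 [imageProj]
    rw [mul_smul_comm, ← mul_assoc, this]
    rfl
  isSelfAdjoint := by
    rw [IsSelfAdjoint, imageProj, star_smul, star_mul, star_star]
    congr 1
    rw [← Complex.ofReal_inv]
    exact Complex.conj_ofReal _

lemma opTrace_smul (c : ℂ) (a : Op d) : opTrace (c • a) = c * opTrace a := by
  simp [opTrace]

lemma opTrace_imageProj (h : IsConformalOn P W) (h0 : W * P ≠ 0) :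
    opTrace (imageProj P W) = opTrace P := by
  have hc : ((‖W * P‖ ^ 2 : ℝ) : ℂ) ≠ 0 := by simpa using h0
  rw [imageProj, opTrace_smul, opTrace_mul_comm, h, opTrace_smul, inv_mul_cancel_left₀ hc]

lemma mul_imageProj (P W V : Op d) :
    V * imageProj P W = ((‖W * P‖ ^ 2 : ℝ) : ℂ)⁻¹ • (V * W * P * star (W * P)) := by
  rw [imageProj, mul_smul_comm]
  simp only [mul_assoc]

lemma star_mul_imageProj_mul (hP : IsStarProjection P) (h0 : W * P ≠ 0)
    (hV : IsConformalOn P (V * W)) :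
    star (V * imageProj P W) * (V * imageProj P W) =
      (((‖V * W * P‖ / ‖W * P‖) ^ 2 : ℝ) : ℂ) • imageProj P W := by
  have hc : (‖W * P‖ : ℂ) ≠ 0 := by
    rw [Complex.ofReal_ne_zero]; exact norm_ne_zero_iff.2 h0
  have e : W * P * (P * star (W * P)) = W * P * star (W * P) := by
    rw [← mul_assoc, mul_assoc W P P, hP.isIdempotentElem.eq]
  rw [mul_imageProj, star_smul, smul_mul_smul_comm, star_mul, star_star, mul_assoc (W * P),
    ← mul_assoc (star (V * W * P)), hV, smul_mul_assoc, mul_smul_comm, e,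
    imageProj, smul_smul, smul_smul]
  congr 1
  rw [← Complex.ofReal_inv, Complex.star_def, Complex.conj_ofReal]
  push_cast
  field_simp

lemma IsConformalOn.comp_imageProj (hP : IsStarProjection P) (hW : IsConformalOn P W)
    (h0 : W * P ≠ 0) (hV : IsConformalOn P (V * W)) : IsConformalOn (imageProj P W) V :=
  isConformalOn_of_eq_smul (isStarProjection_imageProj hP hW h0) (sq_nonneg _)
    (star_mul_imageProj_mul hP h0 hV)

lemma norm_mul_mul_eq (hP : IsStarProjection P) (hW : IsConformalOn P W)
    (h0 : W * P ≠ 0) (hV : IsConformalOn P (V * W)) :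
    ‖V * W * P‖ = ‖W * P‖ * ‖V * imageProj P W‖ := by
  have hc : 0 < ‖W * P‖ := norm_pos_iff.2 h0
  have hQ := isStarProjection_imageProj hP hW h0
  apply le_antisymm
  · have : V * W * P = V * imageProj P W * (W * P) := by
      rw [mul_assoc V (imageProj P W), imageProj_mul hP hW h0, mul_assoc]
    rw [this, mul_comm ‖W * P‖]
    exact norm_mul_le _ _
  · have h1 := norm_star_mul_self_op (V * imageProj P W)
    rw [star_mul_imageProj_mul hP h0 hV, norm_smul, Complex.norm_real,
      Real.norm_of_nonneg (sq_nonneg _)] at h1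
    have h2 : ‖V * imageProj P W‖ ≤ ‖V * W * P‖ / ‖W * P‖ := by
      refine (pow_le_pow_iff_left₀ (norm_nonneg _) (by positivity) two_ne_zero).1 ?_
      rw [sq, ← h1]
      exact mul_le_of_le_one_right (sq_nonneg _) hQ.norm_le
    rw [le_div_iff₀ hc] at h2
    linarith

lemma imageProj_imageProj (hP : IsStarProjection P) (hW : IsConformalOn P W)
    (h0 : W * P ≠ 0) (hV : IsConformalOn P (V * W)) :
    imageProj (imageProj P W) V = imageProj P (V * W) := by
  have hc : (‖W * P‖ : ℂ) ≠ 0 := by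
    rw [Complex.ofReal_ne_zero]; exact norm_ne_zero_iff.2 h0
  have hQ := isStarProjection_imageProj hP hW h0
  have e1 : V * imageProj P W * star (V * imageProj P W) =
      ((‖W * P‖ ^ 2 : ℝ) : ℂ)⁻¹ • (V * W * P * star (V * W * P)) := by
    rw [star_mul, hQ.isSelfAdjoint.star_eq, mul_assoc, ← mul_assoc (imageProj P W),
      hQ.isIdempotentElem.eq, ← mul_assoc, mul_imageProj, smul_mul_assoc]
    simp only [star_mul, mul_assoc]
  rw [imageProj, e1, smul_smul]
  change _ = ((‖V * W * P‖ ^ 2 : ℝ) : ℂ)⁻¹ • (V * W * P * star (V * W * P))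
  congr 1
  rw [norm_mul_mul_eq hP hW h0 hV]
  push_cast
  rw [mul_pow, mul_inv, mul_comm]

/-- For `W` conformal on the range of `P`, this is `‖W * P‖` times the distance of `W e` to the
image of that range, written so as to be visibly continuous in `(P, e)`: see
`angleDefect_eq`. -/
noncomputable def angleDefect (W P : Op d) (e : Hilb d) : ℝ :=
  Real.sqrt (‖W * P‖ ^ 2 * ‖W e‖ ^ 2 - ‖star (W * P) (W e)‖ ^ 2)

lemma angleDefect_nonneg (W P : Op d) (e : Hilb d) : 0 ≤ angleDefect W P e := Real.sqrt_nonneg _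

lemma angleDefect_le (W P : Op d) (e : Hilb d) : angleDefect W P e ≤ ‖W * P‖ * ‖W e‖ := by
  refine Real.sqrt_le_iff.2 ⟨by positivity, ?_⟩
  rw [mul_pow]
  linarith [sq_nonneg ‖star (W * P) (W e)‖]

lemma angleDefect_of_mul_eq_zero (h : W * P = 0) (e : Hilb d) : angleDefect W P e = 0 :=
  le_antisymm ((angleDefect_le W P e).trans (by rw [h, norm_zero, zero_mul]))
    (angleDefect_nonneg W P e)

lemma angleDefect_eq (hP : IsStarProjection P) (h : IsConformalOn P W) (h0 : W * P ≠ 0)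
    (e : Hilb d) : angleDefect W P e = ‖W * P‖ * ‖(1 - imageProj P W) (W e)‖ := by
  have hc : ‖W * P‖ ≠ 0 := norm_ne_zero_iff.2 h0
  have hQ := isStarProjection_imageProj hP h h0
  have h1 : ‖imageProj P W (W e)‖ ^ 2 = (‖W * P‖ ^ 2)⁻¹ * ‖star (W * P) (W e)‖ ^ 2 := by
    rw [hQ.norm_apply_sq, norm_sq_eq_re_inner_star, star_star, imageProj,
      smul_apply, inner_smul_right, ← Complex.ofReal_inv, Complex.re_ofReal_mul]
  have h2 : ‖W * P‖ ^ 2 * ‖W e‖ ^ 2 - ‖star (W * P) (W e)‖ ^ 2 =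
      (‖W * P‖ * ‖(1 - imageProj P W) (W e)‖) ^ 2 := by
    rw [mul_pow, hQ.norm_sub_apply_sq, h1]
    field_simp
  rw [angleDefect, h2, Real.sqrt_sq (by positivity)]

lemma angleDefect_mul (hP : IsStarProjection P) (hW : IsConformalOn P W)
    (h0 : W * P ≠ 0) (hV : IsConformalOn P (V * W)) (e : Hilb d) :
    angleDefect (V * W) P e =
      ‖W * P‖ * angleDefect V (imageProj P W) ((1 - imageProj P W) (W e)) := by
  have hQ := isStarProjection_imageProj hP hW h0
  have hVQ := hW.comp_imageProj hP h0 hV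
  have hn := norm_mul_mul_eq hP hW h0 hV
  by_cases hb : V * W * P = 0
  · have : V * imageProj P W = 0 := by
      rw [hb, norm_zero] at hn
      exact norm_eq_zero.1 ((mul_eq_zero.1 hn.symm).resolve_left (norm_ne_zero_iff.2 h0))
    rw [angleDefect_of_mul_eq_zero hb, angleDefect_of_mul_eq_zero this, mul_zero]
  · have hb' : V * imageProj P W ≠ 0 := fun h => hb (by
      rw [← norm_eq_zero, hn, h, norm_zero, mul_zero])
    have hI := imageProj_mul hQ hVQ hb'
    rw [angleDefect_eq hP hV hb, angleDefect_eq hQ hVQ hb', hn, mul_assoc,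
      imageProj_imageProj hP hW h0 hV]
    rw [imageProj_imageProj hP hW h0 hV] at hI
    congr 3
    have : (1 - imageProj P (V * W)) * (V * (1 - imageProj P W)) =
        (1 - imageProj P (V * W)) * V := by
      rw [mul_sub, mul_one, mul_sub, sub_mul _ _ (V * imageProj P W), hI, one_mul, sub_self,
        sub_zero]
    exact (DFunLike.congr_fun this (W e)).symm

end Conformal

/-! ### Dark projections -/

section DarkProjections

variable {d : ℕ} {m : Measure (Op d)} {r : ℕ} {P : Op d}

/-- The orthogonal projections onto the `r`-dimensional subspaces on which almost every product of
outcomes is conformal. -/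
def darkProjections (m : Measure (Op d)) (r : ℕ) : Set (Op d) :=
  {P | IsStarProjection P ∧ opTrace P = r ∧ ∀ n, ∀ᵐ W ∂(productLaw m n), IsConformalOn P W}

lemma isClosed_isConformalOn : IsClosed {q : Op d × Op d | IsConformalOn q.1 q.2} := by
  refine isClosed_eq ?_ ?_
  · have h : Continuous fun q : Op d × Op d => q.2 * q.1 := by fun_prop
    exact (continuous_star_op.comp h).mul h
  · have : Continuous fun q : Op d × Op d => ((‖q.2 * q.1‖ ^ 2 : ℝ) : ℂ) :=
      Complex.continuous_ofReal.comp (by fun_prop)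
    exact this.smul continuous_fst

lemma measurableSet_isConformalOn (P : Op d) : MeasurableSet {W | IsConformalOn P W} :=
  (isClosed_isConformalOn.preimage (by fun_prop : Continuous fun W : Op d => (P, W))).measurableSet

lemma isClosed_darkProjections : IsClosed (darkProjections m r) := by
  refine IsSeqClosed.isClosed fun p P hp hlim => ⟨⟨?_, ?_⟩, ?_, fun n => ?_⟩
  · have : IsClosed {P : Op d | P * P = P} := isClosed_eq (by fun_prop) (by fun_prop)
    exact this.mem_of_tendsto hlim (.of_forall fun k => (hp k).1.isIdempotentElem)
  · have : IsClosed {P : Op d | star P = P} := isClosed_eq continuous_star_op (by fun_prop)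
    exact this.mem_of_tendsto hlim (.of_forall fun k => (hp k).1.isSelfAdjoint)
  · have : IsClosed {P : Op d | opTrace P = r} := isClosed_eq continuous_opTrace (by fun_prop)
    exact this.mem_of_tendsto hlim (.of_forall fun k => (hp k).2.1)
  · filter_upwards [ae_all_iff.2 fun k => (hp k).2.2 n] with W hW
    exact (isClosed_isConformalOn.preimage
      (by fun_prop : Continuous fun P : Op d => (P, W))).mem_of_tendsto hlim (.of_forall hW)

lemma isCompact_darkProjections : IsCompact (darkProjections m r) := by
  have := FiniteDimensional.proper ℂ (Op d)
  refine Metric.isCompact_of_isClosed_isBounded isClosed_darkProjections ?_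
  exact (Metric.isBounded_closedBall (x := (0 : Op d)) (r := 1)).subset fun P hP => by
    simpa using hP.1.norm_le

lemma imageProj_mem_darkProjections [SFinite m] (hP : P ∈ darkProjections m r) (k : ℕ) :
    ∀ᵐ W ∂(productLaw m k), W * P ≠ 0 → imageProj P W ∈ darkProjections m r := by
  have h : ∀ n, ∀ᵐ W ∂(productLaw m k), ∀ᵐ V ∂(productLaw m n), IsConformalOn P (V * W) :=
    fun n => (ae_productLaw_add n k (measurableSet_isConformalOn P)).1 (hP.2.2 (n + k))
  filter_upwards [hP.2.2 k, ae_all_iff.2 h] with W hW hVW h0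
  refine ⟨isStarProjection_imageProj hP.1 hW h0, (opTrace_imageProj hW h0).trans hP.2.1,
    fun n => ?_⟩
  filter_upwards [hVW n] with V hV
  exact hW.comp_imageProj hP.1 h0 hV

lemma opTrace_zero : opTrace (0 : Op d) = 0 := by simp [opTrace]

lemma exists_unit_fixed (hr : 0 < r) (hP : P ∈ darkProjections m r) :
    ∃ u : Hilb d, ‖u‖ = 1 ∧ P u = u := by
  have h0 : P ≠ 0 := fun h => by
    have := hP.2.1
    rw [h, opTrace_zero] at this
    exact hr.ne (by exact_mod_cast this)
  obtain ⟨x, hx⟩ : ∃ x, P x ≠ 0 := by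
    by_contra! h
    exact h0 (ContinuousLinearMap.ext h)
  refine ⟨((‖P x‖ : ℂ))⁻¹ • P x, ?_, ?_⟩
  · rw [norm_smul, norm_inv, Complex.norm_real, norm_norm, inv_mul_cancel₀ (norm_ne_zero_iff.2 hx)]
  · rw [map_smul]
    congr 1
    exact DFunLike.congr_fun hP.1.isIdempotentElem x

lemma lintegral_norm_mul_sq [SFinite m]
    (hm : ∀ x : Hilb d, ∫⁻ v, ‖v x‖ₑ ^ 2 ∂m = ‖x‖ₑ ^ 2)
    (hr : 0 < r) (hP : P ∈ darkProjections m r) (n : ℕ) :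
    ∫⁻ W, ENNReal.ofReal ‖W * P‖ ^ 2 ∂(productLaw m n) = 1 := by
  obtain ⟨u, hu, hPu⟩ := exists_unit_fixed hr hP
  have h := lintegral_enorm_sq_apply_productLaw hm n u
  rw [← ofReal_norm u, hu, ENNReal.ofReal_one, one_pow] at h
  rw [← h]
  refine lintegral_congr_ae ?_
  filter_upwards [hP.2.2 n] with W hW
  rw [← ofReal_norm (W u), hW.norm_apply hPu, hu, mul_one]

end DarkProjections

/-! ### Decay of the mean angle between a vector and a dark subspace -/

section Decay

variable {d : ℕ} {m : Measure (Op d)} {r : ℕ} {P : Op d}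

lemma continuous_angleDefect :
    Continuous fun q : Op d × Op d × Hilb d => angleDefect q.1 q.2.1 q.2.2 := by
  have h1 : Continuous fun q : Op d × Op d × Hilb d => q.1 * q.2.1 := by fun_prop
  have h2 : Continuous fun q : Op d × Op d × Hilb d => q.1 q.2.2 := by fun_prop
  have h3 : Continuous fun q : Op d × Op d × Hilb d => star (q.1 * q.2.1) (q.1 q.2.2) :=
    (continuous_star_op.comp h1).clm_apply h2
  unfold angleDefect
  fun_prop

lemma measurable_angleDefect (P : Op d) (e : Hilb d) :
    Measurable fun W => ENNReal.ofReal (angleDefect W P e) := by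
  refine ENNReal.measurable_ofReal.comp ?_
  exact (continuous_angleDefect.comp
    (by fun_prop : Continuous fun W : Op d => (W, P, e))).measurable

/-- The mean of `angleDefect` after `n` outcomes. If `e` is a unit vector, it is the mean sine of
the angle between `Wₙ e` and the image of the range of `P`, the mean being for the geometric mean of
the laws of the outcomes from `e` and from the range of `P`. -/
noncomputable def meanDefect (m : Measure (Op d)) (n : ℕ) (P : Op d) (e : Hilb d) : ℝ≥0∞ :=
  ∫⁻ W, ENNReal.ofReal (angleDefect W P e) ∂(productLaw m n)

lemma meanDefect_le [SFinite m] (hm : ∀ x : Hilb d, ∫⁻ v, ‖v x‖ₑ ^ 2 ∂m = ‖x‖ₑ ^ 2)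
    (hr : 0 < r) (hP : P ∈ darkProjections m r) (n : ℕ) (e : Hilb d) :
    meanDefect m n P e ≤ ‖e‖ₑ := by
  -- Cauchy-Schwarz for `‖W * P‖` and `‖W e‖`, whose squares have integrals `1` and `‖e‖ ^ 2`.
  have h := ENNReal.lintegral_mul_le_Lp_mul_Lq (productLaw m n) Real.HolderConjugate.two_two
    (f := fun W => ENNReal.ofReal ‖W * P‖) (g := fun W => ‖W e‖ₑ)
    (by fun_prop) (by fun_prop)
  simp only [ENNReal.rpow_two, lintegral_norm_mul_sq hm hr hP n,
    lintegral_enorm_sq_apply_productLaw hm n e, ENNReal.one_rpow, one_mul] at h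
  rw [← ENNReal.rpow_two, ← ENNReal.rpow_mul, mul_one_div_cancel two_ne_zero,
    ENNReal.rpow_one] at h
  refine le_trans (lintegral_mono fun W => ?_) h
  refine (ENNReal.ofReal_le_ofReal (angleDefect_le W P e)).trans_eq ?_
  rw [ENNReal.ofReal_mul (norm_nonneg _), ofReal_norm (W e)]
  rfl

lemma meanDefect_add_le [SFinite m] {n : ℕ} {κ : ℝ≥0∞}
    (h : ∀ P ∈ darkProjections m r, ∀ e, P e = 0 → meanDefect m n P e ≤ κ * ‖e‖ₑ)
    (k : ℕ) (hP : P ∈ darkProjections m r) (e : Hilb d) :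
    meanDefect m (n + k) P e ≤ κ * meanDefect m k P e := by
  have hpair : ∀ᵐ W ∂(productLaw m k), ∀ᵐ V ∂(productLaw m n), IsConformalOn P (V * W) :=
    (ae_productLaw_add n k (measurableSet_isConformalOn P)).1 (hP.2.2 (n + k))
  rw [meanDefect, lintegral_productLaw_add n k (measurable_angleDefect P e), meanDefect,
    ← lintegral_const_mul _ (measurable_angleDefect P e)]
  refine lintegral_mono_ae ?_
  filter_upwards [hP.2.2 k, hpair, imageProj_mem_darkProjections hP k] with W hW hVW hQ
  by_cases h0 : W * P = 0
  · have : ∀ V, angleDefect (V * W) P e = 0 := fun V =>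
      angleDefect_of_mul_eq_zero (by rw [mul_assoc, h0, mul_zero]) e
    simp [this]
  · have hQ := hQ h0
    have he : imageProj P W ((1 - imageProj P W) (W e)) = 0 :=
      DFunLike.congr_fun hQ.1.mul_one_sub_self (W e)
    calc ∫⁻ V, ENNReal.ofReal (angleDefect (V * W) P e) ∂(productLaw m n)
        = ∫⁻ V, ENNReal.ofReal ‖W * P‖ * ENNReal.ofReal
            (angleDefect V (imageProj P W) ((1 - imageProj P W) (W e))) ∂(productLaw m n) := by
          refine lintegral_congr_ae ?_
          filter_upwards [hVW] with V hV
          rw [angleDefect_mul hP.1 hW h0 hV, ENNReal.ofReal_mul (norm_nonneg _)]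
      _ = ENNReal.ofReal ‖W * P‖ *
            meanDefect m n (imageProj P W) ((1 - imageProj P W) (W e)) := by
          rw [lintegral_const_mul _ (measurable_angleDefect _ _), meanDefect]
      _ ≤ ENNReal.ofReal ‖W * P‖ * (κ * ‖(1 - imageProj P W) (W e)‖ₑ) := by
          gcongr
          exact h _ hQ _ he
      _ = κ * ENNReal.ofReal (angleDefect W P e) := by
          rw [angleDefect_eq hP.1 hW h0, ENNReal.ofReal_mul (norm_nonneg _),
            ofReal_norm ((1 - imageProj P W) (W e))]
          ring

lemma star_rankOne (x y : Hilb d) :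
    star (InnerProductSpace.rankOne ℂ x y : Op d) = InnerProductSpace.rankOne ℂ y x :=
  InnerProductSpace.adjoint_rankOne x y

lemma mul_rankOne (A : Op d) (x y : Hilb d) :
    A * InnerProductSpace.rankOne ℂ x y = InnerProductSpace.rankOne ℂ (A x) y :=
  InnerProductSpace.comp_rankOne x y A

lemma star_op_zero : star (0 : Op d) = 0 :=
  map_zero (ContinuousLinearMap.adjoint : Op d ≃ₗᵢ⋆[ℂ] Op d)

lemma star_op_add (a b : Op d) : star (a + b) = star a + star b := star_add a b

lemma star_mul_mul_rankOne (W : Op d) (e : Hilb d) :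
    star (W * InnerProductSpace.rankOne ℂ e e) * (W * InnerProductSpace.rankOne ℂ e e) =
      ((‖W e‖ ^ 2 : ℝ) : ℂ) • (InnerProductSpace.rankOne ℂ e e : Op d) := by
  rw [mul_rankOne, star_rankOne, mul_rankOne, InnerProductSpace.rankOne_apply,
    inner_self_eq_norm_sq_to_K, map_smul]
  push_cast
  rfl

lemma isStarProjection_add_rankOne {e : Hilb d} (hP : IsStarProjection P)
    (he : ‖e‖ = 1) (hPe : P e = 0) :
    IsStarProjection (P + InnerProductSpace.rankOne ℂ e e) := by
  have hE : IsStarProjection (InnerProductSpace.rankOne ℂ e e : Op d) :=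
    InnerProductSpace.isStarProjection_rankOne_self he
  have h1 : P * InnerProductSpace.rankOne ℂ e e = 0 := by
    rw [mul_rankOne, hPe, map_zero]
    rfl
  have h2 : InnerProductSpace.rankOne ℂ e e * P = 0 := by
    have := congrArg star h1
    rwa [star_mul, star_op_zero, hE.isSelfAdjoint.star_eq, hP.isSelfAdjoint.star_eq] at this
  refine ⟨?_, hP.isSelfAdjoint.add hE.isSelfAdjoint⟩
  rw [IsIdempotentElem, add_mul, mul_add, mul_add, h1, h2, hP.isIdempotentElem.eq,
    hE.isIdempotentElem.eq, add_zero, zero_add]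

lemma isConformalOn_add_rankOne {W : Op d} {e : Hilb d} (hP : IsStarProjection P)
    (hW : IsConformalOn P W) (he : ‖e‖ = 1) (hPe : P e = 0)
    (hn : ‖W e‖ = ‖W * P‖) (ho : star (W * P) (W e) = 0) :
    IsConformalOn (P + InnerProductSpace.rankOne ℂ e e) W := by
  refine isConformalOn_of_eq_smul (isStarProjection_add_rankOne hP he hPe)
    (sq_nonneg ‖W * P‖) ?_
  have h1 : star (W * P) * (W * InnerProductSpace.rankOne ℂ e e) = 0 := by
    rw [mul_rankOne, mul_rankOne, ho, map_zero]
    rfl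
  have h2 : star (W * InnerProductSpace.rankOne ℂ e e) * (W * P) = 0 := by
    have := congrArg star h1
    rwa [star_mul, star_op_zero, star_star] at this
  have h3 := star_mul_mul_rankOne W e
  rw [hn] at h3
  rw [mul_add, star_op_add, add_mul, mul_add, mul_add, h1, h2, h3, hW, add_zero, zero_add, smul_add]

lemma add_rankOne_mem_darkProjections [SFinite m]
    (hm : ∀ x : Hilb d, ∫⁻ v, ‖v x‖ₑ ^ 2 ∂m = ‖x‖ₑ ^ 2)
    (hr : 0 < r) (hP : P ∈ darkProjections m r) {e : Hilb d} (he : ‖e‖ = 1) (hPe : P e = 0)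
    (h : ∀ n, 1 ≤ meanDefect m n P e) :
    P + InnerProductSpace.rankOne ℂ e e ∈ darkProjections m (r + 1) := by
  refine ⟨isStarProjection_add_rankOne hP.1 he hPe, ?_, fun n => ?_⟩
  · have h1 : opTrace (InnerProductSpace.rankOne ℂ e e : Op d) = 1 := by
      rw [opTrace, InnerProductSpace.trace_rankOne, inner_self_eq_norm_sq_to_K, he]
      norm_num
    have h2 : ∀ a b : Op d, opTrace (a + b) = opTrace a + opTrace b := fun a b => by
      simp [opTrace]
    rw [h2, hP.2.1, h1]
    push_cast
    rfl
  have h1 : ∫⁻ W, ENNReal.ofReal ((‖W * P‖ ^ 2 + ‖W e‖ ^ 2) / 2) ∂(productLaw m n) = 1 := by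
    have : ∀ W : Op d, ENNReal.ofReal ((‖W * P‖ ^ 2 + ‖W e‖ ^ 2) / 2) =
        2⁻¹ * (ENNReal.ofReal ‖W * P‖ ^ 2 + ‖W e‖ₑ ^ 2) := fun W => by
      rw [div_eq_inv_mul, ENNReal.ofReal_mul (by norm_num), ENNReal.ofReal_add (by positivity)
        (by positivity), ENNReal.ofReal_pow (norm_nonneg _), ENNReal.ofReal_pow (norm_nonneg _),
        ofReal_norm (W e), ENNReal.ofReal_inv_of_pos two_pos, ENNReal.ofReal_ofNat]
    simp_rw [this]
    rw [lintegral_const_mul _ (by fun_prop), lintegral_add_left (by fun_prop),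
      lintegral_norm_mul_sq hm hr hP n, lintegral_enorm_sq_apply_productLaw hm n e,
      ← ofReal_norm e, he, ENNReal.ofReal_one, one_pow, one_add_one_eq_two]
    exact ENNReal.inv_mul_cancel two_ne_zero ENNReal.ofNat_ne_top
  have h2 := ae_eq_of_ae_le_of_lintegral_le (μ := productLaw m n)
    (f := fun W => ENNReal.ofReal (angleDefect W P e))
    (g := fun W => ENNReal.ofReal ((‖W * P‖ ^ 2 + ‖W e‖ ^ 2) / 2))
    (.of_forall fun W => ENNReal.ofReal_le_ofReal ((angleDefect_le W P e).trans
      (by nlinarith [sq_nonneg (‖W * P‖ - ‖W e‖)])))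
    (((meanDefect_le hm hr hP n e).trans_lt enorm_lt_top).ne)
    (by fun_prop) (by rw [h1]; exact h n)
  -- Equality in `angleDefect ≤ ‖W * P‖ * ‖W e‖ ≤ (‖W * P‖ ^ 2 + ‖W e‖ ^ 2) / 2`.
  filter_upwards [h2, hP.2.2 n] with W hW hWP
  rw [ENNReal.ofReal_eq_ofReal_iff (angleDefect_nonneg _ _ _) (by positivity)] at hW
  have h3 : ‖W e‖ = ‖W * P‖ := by
    have := angleDefect_le W P e
    have h4 : (‖W * P‖ - ‖W e‖) ^ 2 ≤ 0 := by nlinarith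
    have := pow_eq_zero_iff two_ne_zero |>.1 (le_antisymm h4 (sq_nonneg _))
    linarith
  refine isConformalOn_add_rankOne hP.1 hWP he hPe h3 ?_
  rw [h3, angleDefect, h3] at hW
  have h5 : ‖W * P‖ ^ 2 * ‖W * P‖ ^ 2 - ‖star (W * P) (W e)‖ ^ 2 = (‖W * P‖ ^ 2) ^ 2 := by
    have hle : ‖star (W * P) (W e)‖ ≤ ‖W * P‖ * ‖W * P‖ := by
      refine ((star (W * P)).le_opNorm (W e)).trans_eq ?_
      rw [h3]
      congr 1
      exact (ContinuousLinearMap.adjoint : Op d ≃ₗᵢ⋆[ℂ] Op d).norm_map _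
    rw [← Real.sq_sqrt (show 0 ≤ ‖W * P‖ ^ 2 * ‖W * P‖ ^ 2 - ‖star (W * P) (W e)‖ ^ 2 by
      nlinarith [norm_nonneg (star (W * P) (W e)), norm_nonneg (W * P)]), hW]
    ring
  have h6 : ‖star (W * P) (W e)‖ ^ 2 = 0 := by linarith
  exact norm_eq_zero.1 (pow_eq_zero_iff two_ne_zero |>.1 h6)


lemma lintegral_norm_sq_productLaw_lt_top [SFinite m] (hmom : ∫⁻ v, ENNReal.ofReal ‖v‖ ^ 2 ∂m < ⊤)
    (n : ℕ) : ∫⁻ W, ENNReal.ofReal ‖W‖ ^ 2 ∂(productLaw m n) < ⊤ := by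
  induction n with
  | zero =>
    rw [productLaw, lintegral_dirac' _ (by fun_prop)]
    exact ENNReal.pow_lt_top ENNReal.ofReal_lt_top
  | succ n ih =>
    rw [add_comm, lintegral_productLaw_add 1 n (by fun_prop), productLaw_one]
    calc ∫⁻ W, ∫⁻ v, ENNReal.ofReal ‖v * W‖ ^ 2 ∂m ∂(productLaw m n)
        ≤ ∫⁻ W, (∫⁻ v, ENNReal.ofReal ‖v‖ ^ 2 ∂m) * ENNReal.ofReal ‖W‖ ^ 2 ∂(productLaw m n) := by
          refine lintegral_mono fun W => ?_
          rw [← lintegral_mul_const _ (by fun_prop)]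
          refine lintegral_mono fun v => ?_
          rw [← mul_pow, ← ENNReal.ofReal_mul (norm_nonneg _)]
          gcongr
          exact norm_mul_le v W
      _ < ⊤ := by
          rw [lintegral_const_mul _ (by fun_prop)]
          exact ENNReal.mul_lt_top hmom ih

lemma integrable_norm_sq_productLaw [SFinite m]
    (hmom : ∫⁻ v, ENNReal.ofReal ‖v‖ ^ 2 ∂m < ⊤) (n : ℕ) :
    Integrable (fun W : Op d => ‖W‖ ^ 2) (productLaw m n) := by
  refine ⟨by fun_prop, ?_⟩
  refine lt_of_le_of_lt (le_of_eq (lintegral_congr fun W => ?_))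
    (lintegral_norm_sq_productLaw_lt_top hmom n)
  rw [← ofReal_norm, Real.norm_of_nonneg (by positivity), ENNReal.ofReal_pow (norm_nonneg _)]

/-- The pairs of a dark projection and a unit vector in its kernel. -/
def darkPairs (m : Measure (Op d)) (r : ℕ) : Set (Op d × Hilb d) :=
  {q | q.1 ∈ darkProjections m r ∧ ‖q.2‖ = 1 ∧ q.1 q.2 = 0}

lemma isCompact_darkPairs : IsCompact (darkPairs m r) := by
  have h : IsCompact (darkProjections m r ×ˢ Metric.sphere (0 : Hilb d) 1) :=
    isCompact_darkProjections.prod (isCompact_sphere _ _)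
  refine h.of_isClosed_subset ?_ fun q hq => ⟨hq.1, by simpa using hq.2.1⟩
  refine (isClosed_darkProjections.preimage continuous_fst).inter
    ((isClosed_eq (by fun_prop) continuous_const).inter (isClosed_eq ?_ continuous_const))
  exact continuous_fst.clm_apply continuous_snd

lemma continuousOn_integral_angleDefect [SFinite m]
    (hmom : ∫⁻ v, ENNReal.ofReal ‖v‖ ^ 2 ∂m < ⊤) (n : ℕ) :
    ContinuousOn (fun q : Op d × Hilb d => ∫ W, angleDefect W q.1 q.2 ∂(productLaw m n))
      (darkPairs m r) := by
  refine continuousOn_of_dominated (bound := fun W => ‖W‖ ^ 2) ?_ ?_ ?_ ?_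
  · intro q _
    exact (continuous_angleDefect.comp
      (by fun_prop : Continuous fun W : Op d => (W, q.1, q.2))).aestronglyMeasurable
  · intro q hq
    refine .of_forall fun W => ?_
    rw [Real.norm_of_nonneg (angleDefect_nonneg _ _ _), sq]
    refine (angleDefect_le _ _ _).trans ?_
    gcongr
    · refine (norm_mul_le _ _).trans (mul_le_of_le_one_right (norm_nonneg _) hq.1.1.norm_le)
    · simpa [hq.2.1] using W.le_opNorm q.2
  · exact integrable_norm_sq_productLaw hmom n
  · refine .of_forall fun W => Continuous.continuousOn ?_
    have h : Continuous fun q : Op d × Hilb d => (W, q.1, q.2) := by fun_prop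
    have h' := (continuous_angleDefect (d := d)).comp h
    exact h'

lemma integral_angleDefect (n : ℕ) (P : Op d) (e : Hilb d) :
    ∫ W, angleDefect W P e ∂(productLaw m n) = (meanDefect m n P e).toReal := by
  rw [integral_eq_lintegral_of_nonneg_ae (.of_forall fun W => angleDefect_nonneg W P e)]
  · rfl
  · exact (continuous_angleDefect.comp
      (by fun_prop : Continuous fun W : Op d => (W, P, e))).aestronglyMeasurable

lemma angleDefect_smul (W P : Op d) (c : ℂ) (e : Hilb d) :
    angleDefect W P (c • e) = ‖c‖ * angleDefect W P e := by
  rw [angleDefect, angleDefect, map_smul, map_smul, norm_smul, norm_smul]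
  have : ‖W * P‖ ^ 2 * (‖c‖ * ‖W e‖) ^ 2 - (‖c‖ * ‖star (W * P) (W e)‖) ^ 2 =
      ‖c‖ ^ 2 * (‖W * P‖ ^ 2 * ‖W e‖ ^ 2 - ‖star (W * P) (W e)‖ ^ 2) := by ring
  rw [this, Real.sqrt_mul (sq_nonneg _), Real.sqrt_sq (norm_nonneg _)]

lemma meanDefect_smul (n : ℕ) (P : Op d) (c : ℂ) (e : Hilb d) :
    meanDefect m n P (c • e) = ‖c‖ₑ * meanDefect m n P e := by
  simp_rw [meanDefect, angleDefect_smul, ENNReal.ofReal_mul (norm_nonneg c), ofReal_norm c]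
  rw [lintegral_const_mul _ (measurable_angleDefect P e)]

/-- If there is no dark subspace of dimension `r + 1`, the Cauchy-Schwarz inequality behind
`meanDefect_le` is strict after finitely many steps, uniformly by compactness. -/
lemma exists_meanDefect_le_lt_one [SFinite m]
    (hm : ∀ x : Hilb d, ∫⁻ v, ‖v x‖ₑ ^ 2 ∂m = ‖x‖ₑ ^ 2)
    (hmom : ∫⁻ v, ENNReal.ofReal ‖v‖ ^ 2 ∂m < ⊤)
    (hr : 0 < r) (hmax : darkProjections m (r + 1) = ∅) :
    ∃ n, ∃ κ : ℝ≥0∞, κ < 1 ∧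
      ∀ P ∈ darkProjections m r, ∀ e, P e = 0 → meanDefect m n P e ≤ κ * ‖e‖ₑ := by
  set f : ℕ → Op d × Hilb d → ℝ := fun n q => ∫ W, angleDefect W q.1 q.2 ∂(productLaw m n) with hf
  have hfin : ∀ n, ∀ q ∈ darkPairs m r, meanDefect m n q.1 q.2 ≠ ⊤ := fun n q hq =>
    ((meanDefect_le hm hr hq.1 n q.2).trans_lt enorm_lt_top).ne
  have hle : ∀ n, ∀ q ∈ darkPairs m r, 1 ≤ f n q → 1 ≤ meanDefect m n q.1 q.2 := by
    intro n q hq h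
    simp only [hf, integral_angleDefect] at h
    exact (ENNReal.toReal_le_toReal ENNReal.one_ne_top (hfin n q hq)).1 (by simpa using h)
  have hmono : ∀ n, ∀ q ∈ darkPairs m r, f (n + 1) q ≤ f n q := by
    intro n q hq
    simp only [hf, integral_angleDefect]
    refine ENNReal.toReal_mono (hfin n q hq) ?_
    have := meanDefect_add_le (m := m) (n := 1) (κ := 1)
      (fun P hP e _ => by rw [one_mul]; exact meanDefect_le hm hr hP 1 e) n hq.1 q.2
    rwa [one_mul, add_comm] at this
  -- After some `n`, the continuous function `f n` is below `1` on the compact set of pairs.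
  obtain ⟨n, hn⟩ : ∃ n, ∀ q ∈ darkPairs m r, f n q < 1 := by
    by_contra! hcon
    have hclosed : ∀ n, IsClosed {q ∈ darkPairs m r | 1 ≤ f n q} := fun n =>
      (continuousOn_integral_angleDefect hmom n).preimage_isClosed_of_isClosed
        isCompact_darkPairs.isClosed isClosed_Ici
    obtain ⟨q, hq⟩ := IsCompact.nonempty_iInter_of_sequence_nonempty_isCompact_isClosed
      (fun n => {q ∈ darkPairs m r | 1 ≤ f n q})
      (fun n q hq => ⟨hq.1, hq.2.trans (hmono n q hq.1)⟩)
      (fun n => let ⟨q, hq, h⟩ := hcon n; ⟨q, hq, h⟩)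
      (isCompact_darkPairs.of_isClosed_subset (hclosed 0) fun q hq => hq.1) hclosed
    rw [Set.mem_iInter] at hq
    have hq0 := (hq 0).1
    have := add_rankOne_mem_darkProjections hm hr hq0.1 hq0.2.1 hq0.2.2
      fun n => hle n q hq0 (hq n).2
    rw [hmax] at this
    exact this
  obtain ⟨κ, hκ1, hκ⟩ : ∃ κ : ℝ, κ < 1 ∧ ∀ q ∈ darkPairs m r, f n q ≤ κ := by
    rcases (darkPairs m r).eq_empty_or_nonempty with h | h
    · exact ⟨0, one_pos, by simp [h]⟩
    · obtain ⟨q, hq, hmaxq⟩ := isCompact_darkPairs.exists_isMaxOn h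
        (continuousOn_integral_angleDefect hmom n)
      exact ⟨f n q, hn q hq, fun q' hq' => hmaxq hq'⟩
  refine ⟨n, ENNReal.ofReal κ, by simpa using hκ1, fun P hP e he => ?_⟩
  by_cases h0 : e = 0
  · have : meanDefect m n P e ≤ ‖e‖ₑ := meanDefect_le hm hr hP n e
    rw [h0, enorm_zero] at this ⊢
    simpa using this
  · have hne : (‖e‖ : ℂ) ≠ 0 := by rw [Complex.ofReal_ne_zero]; exact norm_ne_zero_iff.2 h0
    have hpair : (P, (‖e‖ : ℂ)⁻¹ • e) ∈ darkPairs m r := by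
      refine ⟨hP, ?_, ?_⟩
      · change ‖(‖e‖ : ℂ)⁻¹ • e‖ = 1
        rw [norm_smul, norm_inv, Complex.norm_real, norm_norm,
          inv_mul_cancel₀ (norm_ne_zero_iff.2 h0)]
      · change P ((‖e‖ : ℂ)⁻¹ • e) = 0
        rw [map_smul, he, smul_zero]
    have h1 := hκ _ hpair
    simp only [hf, integral_angleDefect] at h1
    have h2 := ENNReal.le_ofReal_iff_toReal_le (hfin n _ hpair)
      (ENNReal.toReal_nonneg.trans h1) |>.2 h1
    have h3 := meanDefect_smul (m := m) n P (‖e‖ : ℂ) ((‖e‖ : ℂ)⁻¹ • e)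
    rw [smul_inv_smul₀ hne] at h3
    rw [h3, mul_comm, ← ofReal_norm (‖e‖ : ℂ), Complex.norm_real, norm_norm, ofReal_norm e]
    gcongr

lemma exists_forall_meanDefect_le [SFinite m]
    (hm : ∀ x : Hilb d, ∫⁻ v, ‖v x‖ₑ ^ 2 ∂m = ‖x‖ₑ ^ 2)
    (hmom : ∫⁻ v, ENNReal.ofReal ‖v‖ ^ 2 ∂m < ⊤)
    (hr : 0 < r) (hmax : darkProjections m (r + 1) = ∅) {ε : ℝ≥0∞} (hε : ε ≠ 0) :
    ∃ N, ∀ n ≥ N, ∀ P ∈ darkProjections m r, ∀ e, P e = 0 → meanDefect m n P e ≤ ε * ‖e‖ₑ := by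
  obtain ⟨n₁, κ, hκ1, hκ⟩ := exists_meanDefect_le_lt_one hm hmom hr hmax
  have hpow : ∀ j k, ∀ P ∈ darkProjections m r, ∀ e, P e = 0 →
      meanDefect m (n₁ * j + k) P e ≤ κ ^ j * ‖e‖ₑ := by
    intro j
    induction j with
    | zero => intro k P hP e _; simpa using meanDefect_le hm hr hP k e
    | succ j ih =>
      intro k P hP e he
      rw [show n₁ * (j + 1) + k = n₁ + (n₁ * j + k) by ring, pow_succ', mul_assoc]
      exact (meanDefect_add_le hκ _ hP e).trans (by gcongr; exact ih k P hP e he)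
  have hlim := ENNReal.tendsto_pow_atTop_nhds_zero_of_lt_one hκ1
  obtain ⟨j, hj⟩ := (hlim.eventually (ge_mem_nhds (pos_iff_ne_zero.2 hε))).exists
  refine ⟨n₁ * j, fun n hn P hP e he => ?_⟩
  obtain ⟨k, rfl⟩ := Nat.exists_eq_add_of_le hn
  exact (hpow j k P hP e he).trans (by gcongr)

end Decay

/-! ### Dark subspaces and dark projections -/

section DarkSubspaces

variable {d : ℕ} {μ : Measure (Op d)}

lemma exists_unitary_iff_isConformalOn (D : Submodule ℂ (Hilb d)) (W : Op d) :
    (∃ c : ℝ, 0 ≤ c ∧ ∃ U ∈ unitary (Op d), ∀ x ∈ D, W x = (c : ℂ) • U x) ↔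
      IsConformalOn D.starProjection W := by
  have hP : IsStarProjection D.starProjection := isStarProjection_starProjection
  constructor
  · rintro ⟨c, hc, U, hU, h⟩
    refine isConformalOn_of_eq_smul hP (sq_nonneg c) ?_
    have h1 : W * D.starProjection = (c : ℂ) • (U * D.starProjection) := by
      ext1 x
      exact h _ (D.starProjection_apply_mem x)
    rw [h1, star_smul, smul_mul_smul_comm, star_mul, mul_assoc, ← mul_assoc (star U),
      (Unitary.mem_iff.1 hU).1, one_mul, hP.isSelfAdjoint.star_eq, hP.isIdempotentElem.eq]
    congr 1
    rw [Complex.star_def, Complex.conj_ofReal]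
    push_cast
    ring
  · intro h
    refine ⟨‖W * D.starProjection‖, norm_nonneg _, ?_⟩
    have hn : ∀ x ∈ D, ‖W x‖ = ‖W * D.starProjection‖ * ‖x‖ := fun x hx =>
      h.norm_apply (D.starProjection_eq_self_iff.2 hx)
    by_cases h0 : W * D.starProjection = 0
    · refine ⟨1, one_mem _, fun x hx => ?_⟩
      have := hn x hx
      rw [h0, norm_zero, zero_mul, norm_eq_zero] at this
      rw [this, h0, norm_zero, Complex.ofReal_zero, zero_smul]
    · have hc : (‖W * D.starProjection‖ : ℂ) ≠ 0 := by
        rw [Complex.ofReal_ne_zero]; exact norm_ne_zero_iff.2 h0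
      let L : D →ₗᵢ[ℂ] Hilb d :=
        { toLinearMap := (‖W * D.starProjection‖ : ℂ)⁻¹ • (W.toLinearMap ∘ₗ D.subtype)
          norm_map' := fun x => by
            change ‖(‖W * D.starProjection‖ : ℂ)⁻¹ • W x‖ = ‖(x : Hilb d)‖
            rw [norm_smul, hn x x.2, norm_inv, Complex.norm_real, norm_norm,
              inv_mul_cancel_left₀ (norm_ne_zero_iff.2 h0)] }
      refine ⟨Unitary.linearIsometryEquiv.symm (L.extend.toLinearIsometryEquiv rfl),
        SetLike.coe_mem _, fun x hx => ?_⟩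
      · have h1 := L.extend_apply ⟨x, hx⟩
        change L.extend x = (‖W * D.starProjection‖ : ℂ)⁻¹ • W x at h1
        change _ = (‖W * D.starProjection‖ : ℂ) • L.extend x
        rw [h1, smul_inv_smul₀ hc]

lemma isConformalOn_one {P : Op d} (hP : IsStarProjection P) : IsConformalOn P 1 := by
  refine isConformalOn_of_eq_smul hP zero_le_one ?_
  rw [one_mul, hP.isSelfAdjoint.star_eq, hP.isIdempotentElem.eq, Complex.ofReal_one, one_smul]

lemma isConformalOn_zero (P : Op d) : IsConformalOn P 0 := by
  rw [IsConformalOn, zero_mul, mul_zero, norm_zero, zero_pow two_ne_zero, Complex.ofReal_zero]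
  exact (zero_smul ℂ P).symm

lemma isDark_iff [SigmaFinite (nonzeroPart μ)] (D : Submodule ℂ (Hilb d)) :
    IsDark μ D ↔ D ≠ ⊥ ∧ ∀ n, ∀ᵐ W ∂(productLaw (nonzeroPart μ) n),
      IsConformalOn D.starProjection W := by
  simp_rw [IsDark, exists_unitary_iff_isConformalOn,
    fun n => ae_pi_prodOp_iff (μ := μ) n (isConformalOn_zero _)
      (measurableSet_isConformalOn D.starProjection)]
  refine and_congr_right fun _ => ⟨fun h n => ?_, fun h n _ => h n⟩
  rcases n with _ | n
  · rw [productLaw, ae_dirac_iff (measurableSet_isConformalOn _)]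
    exact isConformalOn_one isStarProjection_starProjection
  · exact h (n + 1) (by omega)

lemma opTrace_starProjection (D : Submodule ℂ (Hilb d)) :
    opTrace D.starProjection = Module.finrank ℂ D := by
  refine LinearMap.IsProj.trace ⟨fun x => D.starProjection_apply_mem x, fun x hx =>
    D.starProjection_eq_self_iff.2 hx⟩

lemma mem_darkProjections_iff [SigmaFinite (nonzeroPart μ)] {r : ℕ} (hr : 0 < r) (P : Op d) :
    P ∈ darkProjections (nonzeroPart μ) r ↔
      ∃ D, IsDark μ D ∧ Module.finrank ℂ D = r ∧ D.starProjection = P := by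
  constructor
  · rintro ⟨hP, ht, h⟩
    obtain ⟨D, _, rfl⟩ := isStarProjection_iff_eq_starProjection.1 hP
    have hD : Module.finrank ℂ D = r := by
      rw [opTrace_starProjection] at ht
      exact_mod_cast ht
    refine ⟨D, (isDark_iff D).2 ⟨?_, h⟩, hD, rfl⟩
    rintro rfl
    rw [finrank_bot] at hD
    exact hr.ne hD
  · rintro ⟨D, hD, hr, rfl⟩
    exact ⟨isStarProjection_starProjection, by rw [opTrace_starProjection, hr],
      ((isDark_iff D).1 hD).2⟩

lemma isDark_span_singleton [SigmaFinite (nonzeroPart μ)] {e : Hilb d} (he : ‖e‖ = 1) :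
    IsDark μ (ℂ ∙ e) := by
  refine (isDark_iff _).2 ⟨?_, fun n => .of_forall fun W => ?_⟩
  · rw [Ne, Submodule.span_singleton_eq_bot]
    exact norm_ne_zero_iff.1 (by rw [he]; exact one_ne_zero)
  · have h1 : (ℂ ∙ e).starProjection = InnerProductSpace.rankOne ℂ e e := by
      ext1 x
      rw [Submodule.starProjection_unit_singleton ℂ he, InnerProductSpace.rankOne_apply]
    rw [h1]
    exact isConformalOn_of_eq_smul (InnerProductSpace.isStarProjection_rankOne_self he)
      (sq_nonneg ‖W e‖) (star_mul_mul_rankOne W e)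

/-- `r` is the largest dimension of a dark subspace, and `darkProjections` then consists of the
projections onto the elements of `maximalDark μ`. -/
structure IsMaximalDarkDim (μ : Measure (Op d)) (r : ℕ) : Prop where
  pos : 0 < r
  nonempty : (darkProjections (nonzeroPart μ) r).Nonempty
  succ_eq_empty : darkProjections (nonzeroPart μ) (r + 1) = ∅
  mem_iff : ∀ P : Op d, P ∈ darkProjections (nonzeroPart μ) r ↔
    ∃ D ∈ maximalDark μ, D.starProjection = P

lemma exists_isMaximalDarkDim [SigmaFinite (nonzeroPart μ)] (hd : 2 ≤ d) :
    ∃ r, IsMaximalDarkDim μ r := by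
  have h0 : (0 : ℕ) < d := by omega
  let e : Hilb d := EuclideanSpace.single ⟨0, h0⟩ 1
  have he : ‖e‖ = 1 := by simp [e]
  let dims : Set ℕ := {k | ∃ D, IsDark μ D ∧ Module.finrank ℂ D = k}
  have hne : dims.Nonempty := ⟨_, _, isDark_span_singleton he, rfl⟩
  have hbdd : BddAbove dims := by
    refine ⟨d, ?_⟩
    rintro _ ⟨D, _, rfl⟩
    simpa using Submodule.finrank_le D
  obtain ⟨D₀, hD₀, hr⟩ := Nat.sSup_mem hne hbdd
  have hle : ∀ D, IsDark μ D → Module.finrank ℂ D ≤ sSup dims := fun D hD =>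
    le_csSup hbdd ⟨D, hD, rfl⟩
  have hpos : 0 < sSup dims := by
    rw [← hr]
    exact Nat.pos_of_ne_zero fun h => hD₀.1 (Submodule.finrank_eq_zero.1 h)
  refine ⟨sSup dims, hpos, ⟨_, (mem_darkProjections_iff hpos _).2 ⟨D₀, hD₀, hr, rfl⟩⟩, ?_, fun P => ?_⟩
  · refine Set.eq_empty_of_forall_notMem fun P hP => ?_
    obtain ⟨D, hD, hDr, -⟩ := (mem_darkProjections_iff (Nat.succ_pos _) P).1 hP
    have := hle D hD
    omega
  · rw [mem_darkProjections_iff hpos]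
    constructor
    · rintro ⟨D, hD, hDr, hP⟩
      exact ⟨D, ⟨hD, fun D' hD' => hDr ▸ hle D' hD'⟩, hP⟩
    · rintro ⟨D, ⟨hD, hDmax⟩, hP⟩
      exact ⟨D, hD, le_antisymm (hle D hD) (hr ▸ hDmax D₀ hD₀), hP⟩

lemma IsMaximalDarkDim.darkDefect_eq_iInf {r : ℕ} (h : IsMaximalDarkDim μ r) (ρ : Op d) :
    darkDefect μ ρ =
      ⨅ P : darkProjections (nonzeroPart μ) r, (1 - (opTrace (P.1 * ρ)).re) := by
  refine Function.Surjective.iInf_congr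
    (fun D : maximalDark μ => (⟨D.1.starProjection, (h.mem_iff _).2 ⟨D.1, D.2, rfl⟩⟩ :
      darkProjections (nonzeroPart μ) r)) ?_ fun D => rfl
  rintro ⟨P, hP⟩
  obtain ⟨D, hD, rfl⟩ := (h.mem_iff P).1 hP
  exact ⟨⟨D, hD⟩, rfl⟩

end DarkSubspaces

/-! ### States as families of vectors -/

section States

variable {d : ℕ}

/-- The probability density of the (possibly composite) outcome `W` in the state `ρ`. -/
noncomputable def outcomeDensity (ρ : DensityMatrix d) (W : Op d) : ℝ :=
  (opTrace (W * ρ.1 * star W)).re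

/-- `u` is a family of vectors with `ρ = ∑ i, |u i⟩⟨u i|`. -/
def IsEnsemble (u : Fin d → Hilb d) (ρ : DensityMatrix d) : Prop :=
  ρ.1 = ∑ i, InnerProductSpace.rankOne ℂ (u i) (u i)

lemma exists_isEnsemble (ρ : DensityMatrix d) : ∃ u, IsEnsemble u ρ := by
  have hT := ρ.2.1
  have hd : Module.finrank ℂ (Hilb d) = d := finrank_euclideanSpace_fin
  let b := hT.isSymmetric.eigenvectorBasis hd
  let l := hT.isSymmetric.eigenvalues hd
  have hl : ∀ i, 0 ≤ l i := hT.toLinearMap.nonneg_eigenvalues hd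
  have hb : ∀ i, ρ.1 (b i) = (l i : ℂ) • b i := hT.isSymmetric.apply_eigenvectorBasis hd
  refine ⟨fun i => (Real.sqrt (l i) : ℂ) • b i, ?_⟩
  have h1 : ρ.1 = ρ.1 * ∑ i, InnerProductSpace.rankOne ℂ (b i) (b i) := by
    have := b.sum_rankOne_eq_id
    rw [this]; rfl
  unfold IsEnsemble
  conv_lhs => rw [h1]
  rw [Finset.mul_sum]
  refine Finset.sum_congr rfl fun i _ => ?_
  rw [mul_rankOne, hb]
  ext1 x
  simp only [InnerProductSpace.rankOne_apply, inner_smul_left, smul_smul, Complex.conj_ofReal]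
  congr 1
  rw [mul_right_comm, ← Complex.ofReal_mul, Real.mul_self_sqrt (hl i), mul_comm]

variable {u : Fin d → Hilb d} {ρ : DensityMatrix d}

lemma opTrace_sum {ι : Type*} (s : Finset ι) (f : ι → Op d) :
    opTrace (∑ i ∈ s, f i) = ∑ i ∈ s, opTrace (f i) := by
  simp [opTrace]

lemma IsEnsemble.opTrace_mul_conj (hu : IsEnsemble u ρ) {Q : Op d} (hQ : IsStarProjection Q)
    (W : Op d) :
    opTrace (Q * (W * ρ.1 * star W)) = ((∑ i, ‖Q (W (u i))‖ ^ 2 : ℝ) : ℂ) := by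
  have h1 : opTrace (Q * (W * ρ.1 * star W)) = opTrace (Q * W * ρ.1 * star (Q * W)) := by
    rw [star_mul, hQ.isSelfAdjoint.star_eq, ← mul_assoc _ (star W) Q, opTrace_mul_comm _ Q]
    simp only [← mul_assoc, hQ.isIdempotentElem.eq]
  rw [h1, hu, Finset.mul_sum, Finset.sum_mul, opTrace_sum]
  push_cast
  refine Finset.sum_congr rfl fun i _ => ?_
  rw [opTrace_mul_comm, mul_rankOne, mul_rankOne, opTrace, InnerProductSpace.trace_rankOne,
    ContinuousLinearMap.star_eq_adjoint, ContinuousLinearMap.adjoint_inner_right,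
    inner_self_eq_norm_sq_to_K]
  rfl

lemma IsEnsemble.opTrace_mul (hu : IsEnsemble u ρ) {Q : Op d} (hQ : IsStarProjection Q) :
    opTrace (Q * ρ.1) = ((∑ i, ‖Q (u i)‖ ^ 2 : ℝ) : ℂ) := by
  have h : star (1 : Op d) = 1 := star_one _
  have := hu.opTrace_mul_conj hQ 1
  rwa [h, mul_one, one_mul] at this

lemma IsEnsemble.opTrace_conj (hu : IsEnsemble u ρ) (W : Op d) :
    opTrace (W * ρ.1 * star W) = ((∑ i, ‖W (u i)‖ ^ 2 : ℝ) : ℂ) := by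
  have := hu.opTrace_mul_conj (.one (Op d)) W
  rwa [one_mul] at this

lemma IsEnsemble.outcomeDensity_eq (hu : IsEnsemble u ρ) (W : Op d) :
    outcomeDensity ρ W = ∑ i, ‖W (u i)‖ ^ 2 := by
  rw [outcomeDensity, hu.opTrace_conj, Complex.ofReal_re]

lemma IsEnsemble.sum_norm_sq (hu : IsEnsemble u ρ) : ∑ i, ‖u i‖ ^ 2 = 1 := by
  have := hu.opTrace_mul (.one (Op d))
  rw [one_mul, ρ.2.2] at this
  exact_mod_cast this.symm

lemma outcomeDensity_nonneg (ρ : DensityMatrix d) (W : Op d) : 0 ≤ outcomeDensity ρ W := by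
  obtain ⟨u, hu⟩ := exists_isEnsemble ρ
  rw [hu.outcomeDensity_eq]
  positivity

lemma opTrace_conj_eq (ρ : DensityMatrix d) (W : Op d) :
    opTrace (W * ρ.1 * star W) = (outcomeDensity ρ W : ℂ) := by
  obtain ⟨u, hu⟩ := exists_isEnsemble ρ
  rw [hu.outcomeDensity_eq, hu.opTrace_conj]

lemma updateState_val {W : Op d} (h : outcomeDensity ρ W ≠ 0) :
    (updateState ρ W).1 = (outcomeDensity ρ W : ℂ)⁻¹ • (W * ρ.1 * star W) := by
  have h' : opTrace (W * ρ.1 * star W) ≠ 0 := by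
    rw [opTrace_conj_eq]; exact_mod_cast h
  rw [← opTrace_conj_eq, updateState, dif_neg h']

lemma outcomeDensity_mul (V : Op d) {W : Op d} (h : outcomeDensity ρ W ≠ 0) :
    outcomeDensity (updateState ρ W) V * outcomeDensity ρ W = outcomeDensity ρ (V * W) := by
  have h1 : opTrace (V * (updateState ρ W).1 * star V) =
      (outcomeDensity ρ W : ℂ)⁻¹ * outcomeDensity ρ (V * W) := by
    rw [updateState_val h, mul_smul_comm, smul_mul_assoc, opTrace_smul, ← opTrace_conj_eq ρ (V * W),
      star_mul]
    simp only [mul_assoc]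
  rw [opTrace_conj_eq] at h1
  have h2 : outcomeDensity (updateState ρ W) V =
      (outcomeDensity ρ W)⁻¹ * outcomeDensity ρ (V * W) := by exact_mod_cast h1
  rw [h2]
  field_simp

lemma outcomeDensity_mul_of_eq_zero (V : Op d) {W : Op d} (h : outcomeDensity ρ W = 0) :
    outcomeDensity ρ (V * W) = 0 := by
  obtain ⟨u, hu⟩ := exists_isEnsemble ρ
  rw [hu.outcomeDensity_eq, Finset.sum_eq_zero_iff_of_nonneg fun i _ => by positivity] at h
  rw [hu.outcomeDensity_eq]
  refine Finset.sum_eq_zero fun i hi => ?_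
  have : W (u i) = 0 := by simpa using h i hi
  rw [mul_apply_eq_comp, this, map_zero, norm_zero, zero_pow two_ne_zero]

lemma updateState_updateState {V W : Op d} (h : outcomeDensity ρ (V * W) ≠ 0) :
    updateState (updateState ρ W) V = updateState ρ (V * W) := by
  have hW : outcomeDensity ρ W ≠ 0 := fun h0 => h (outcomeDensity_mul_of_eq_zero V h0)
  have hm := outcomeDensity_mul V hW
  have hV : outcomeDensity (updateState ρ W) V ≠ 0 := fun h0 => h (by rw [← hm, h0, zero_mul])
  apply Subtype.ext
  rw [updateState_val hV, updateState_val h, updateState_val hW, ← hm, mul_smul_comm,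
    smul_mul_assoc, smul_smul, star_mul]
  push_cast
  rw [mul_inv]
  simp only [mul_assoc]

lemma outcomeDensity_one (ρ : DensityMatrix d) : outcomeDensity ρ 1 = 1 := by
  have h : star (1 : Op d) = 1 := star_one _
  rw [outcomeDensity, h, mul_one, one_mul, ρ.2.2, Complex.one_re]

lemma updateState_one (ρ : DensityMatrix d) : updateState ρ 1 = ρ := by
  have h : star (1 : Op d) = 1 := star_one _
  apply Subtype.ext
  rw [updateState_val (by rw [outcomeDensity_one]; exact one_ne_zero), outcomeDensity_one, h,
    mul_one, one_mul, Complex.ofReal_one, inv_one, one_smul]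

lemma measurable_outcomeDensity :
    Measurable fun p : DensityMatrix d × Op d => outcomeDensity p.1 p.2 := by
  have hc : Continuous fun p : DensityMatrix d × Op d => p.2 * p.1.1 * star p.2 :=
    (continuous_snd.mul (continuous_subtype_val.comp continuous_fst)).mul
      (continuous_star_op.comp continuous_snd)
  exact (Complex.continuous_re.comp (continuous_opTrace.comp hc)).measurable

lemma measurable_outcomeDensity_right (ρ : DensityMatrix d) :
    Measurable fun W : Op d => ENNReal.ofReal (outcomeDensity ρ W) := by
  have h := (ENNReal.measurable_ofReal.comp measurable_outcomeDensity).comp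
    (measurable_prodMk_left (x := ρ))
  exact h

end States

/-! ### The Markov operator of the state -/

section Evolution

variable {d : ℕ} {m : Measure (Op d)} {F G : DensityMatrix d → ℝ≥0∞}

/-- The expectation of `F` at the state reached after `n` outcomes from the state `ρ`. -/
noncomputable def evolve (m : Measure (Op d)) (n : ℕ) (F : DensityMatrix d → ℝ≥0∞)
    (ρ : DensityMatrix d) : ℝ≥0∞ :=
  ∫⁻ W, F (updateState ρ W) * ENNReal.ofReal (outcomeDensity ρ W) ∂(productLaw m n)

lemma measurable_evolve_integrand (hF : Measurable F) :
    Measurable fun p : DensityMatrix d × Op d =>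
      F (updateState p.1 p.2) * ENNReal.ofReal (outcomeDensity p.1 p.2) :=
  (hF.comp measurable_updateState).mul (ENNReal.measurable_ofReal.comp measurable_outcomeDensity)

lemma measurable_evolve [SFinite m] (hF : Measurable F) (n : ℕ) : Measurable (evolve m n F) :=
  (measurable_evolve_integrand hF).lintegral_prod_right'

lemma measurable_evolve_integrand_left (hF : Measurable F) (ρ : DensityMatrix d) :
    Measurable fun W : Op d => F (updateState ρ W) * ENNReal.ofReal (outcomeDensity ρ W) := by
  have h := (measurable_evolve_integrand hF).comp (measurable_prodMk_left (x := ρ))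
  exact h

lemma evolve_mono (h : F ≤ G) (n : ℕ) : evolve m n F ≤ evolve m n G := fun ρ =>
  lintegral_mono fun W => by gcongr; exact h _

lemma evolve_const_mul (hF : Measurable F) (c : ℝ≥0∞) (n : ℕ) (ρ : DensityMatrix d) :
    evolve m n (fun ρ => c * F ρ) ρ = c * evolve m n F ρ := by
  simp_rw [evolve, mul_assoc]
  exact lintegral_const_mul _ (measurable_evolve_integrand_left hF ρ)

lemma evolve_add_left (hF : Measurable F) (n : ℕ) (ρ : DensityMatrix d) :
    evolve m n (fun ρ => F ρ + G ρ) ρ = evolve m n F ρ + evolve m n G ρ := by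
  simp_rw [evolve, add_mul]
  exact lintegral_add_left (measurable_evolve_integrand_left hF ρ) _

lemma lintegral_outcomeDensity [SFinite m]
    (hm : ∀ x : Hilb d, ∫⁻ v, ‖v x‖ₑ ^ 2 ∂m = ‖x‖ₑ ^ 2) (n : ℕ) (ρ : DensityMatrix d) :
    ∫⁻ W, ENNReal.ofReal (outcomeDensity ρ W) ∂(productLaw m n) = 1 := by
  obtain ⟨u, hu⟩ := exists_isEnsemble ρ
  have h : ∀ x : Hilb d, ENNReal.ofReal (‖x‖ ^ 2) = ‖x‖ₑ ^ 2 := fun x => by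
    rw [ENNReal.ofReal_pow (norm_nonneg _), ofReal_norm x]
  simp_rw [hu.outcomeDensity_eq, ENNReal.ofReal_sum_of_nonneg fun i _ => sq_nonneg ‖_‖, h]
  rw [lintegral_finsetSum _ (by fun_prop)]
  simp_rw [lintegral_enorm_sq_apply_productLaw hm n, ← h]
  rw [← ENNReal.ofReal_sum_of_nonneg fun i _ => by positivity, hu.sum_norm_sq, ENNReal.ofReal_one]

lemma evolve_const [SFinite m] (hm : ∀ x : Hilb d, ∫⁻ v, ‖v x‖ₑ ^ 2 ∂m = ‖x‖ₑ ^ 2)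
    (n : ℕ) (c : ℝ≥0∞) (ρ : DensityMatrix d) : evolve m n (fun _ => c) ρ = c := by
  rw [evolve, lintegral_const_mul _ (measurable_outcomeDensity_right ρ), lintegral_outcomeDensity hm, mul_one]

lemma evolve_zero (hF : Measurable F) (ρ : DensityMatrix d) : evolve m 0 F ρ = F ρ := by
  rw [evolve, productLaw, lintegral_dirac' _ (measurable_evolve_integrand_left hF ρ), outcomeDensity_one,
    updateState_one, ENNReal.ofReal_one, mul_one]

lemma evolve_add [SFinite m] (hF : Measurable F) (a b : ℕ) (ρ : DensityMatrix d) :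
    evolve m (a + b) F ρ = evolve m b (evolve m a F) ρ := by
  rw [evolve, lintegral_productLaw_add a b (measurable_evolve_integrand_left hF ρ), evolve]
  refine lintegral_congr fun W => ?_
  by_cases hW : outcomeDensity ρ W = 0
  · simp [hW, outcomeDensity_mul_of_eq_zero _ hW]
  · rw [evolve, ← lintegral_mul_const _ (measurable_evolve_integrand_left hF _)]
    refine lintegral_congr fun V => ?_
    rw [mul_assoc, ← ENNReal.ofReal_mul (outcomeDensity_nonneg _ _), outcomeDensity_mul V hW]
    by_cases hV : outcomeDensity ρ (V * W) = 0
    · simp [hV]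
    · rw [updateState_updateState hV]

end Evolution

/-! ### The defect of a state -/

section Defect

variable {d : ℕ} {μ : Measure (Op d)} {r : ℕ} {ρ : DensityMatrix d} {u : Fin d → Hilb d}
  {P : Op d}

lemma IsEnsemble.one_sub_opTrace (hu : IsEnsemble u ρ) {Q : Op d} (hQ : IsStarProjection Q) :
    1 - (opTrace (Q * ρ.1)).re = ∑ i, ‖(1 - Q) (u i)‖ ^ 2 := by
  rw [hu.opTrace_mul hQ, Complex.ofReal_re, ← hu.sum_norm_sq, ← Finset.sum_sub_distrib]
  exact Finset.sum_congr rfl fun i _ => (hQ.norm_sub_apply_sq (u i)).symm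

lemma one_sub_opTrace_nonneg (ρ : DensityMatrix d) {Q : Op d} (hQ : IsStarProjection Q) :
    0 ≤ 1 - (opTrace (Q * ρ.1)).re := by
  obtain ⟨u, hu⟩ := exists_isEnsemble ρ
  rw [hu.one_sub_opTrace hQ]
  positivity

lemma opTrace_mul_re_nonneg (ρ : DensityMatrix d) {Q : Op d} (hQ : IsStarProjection Q) :
    0 ≤ (opTrace (Q * ρ.1)).re := by
  obtain ⟨u, hu⟩ := exists_isEnsemble ρ
  rw [hu.opTrace_mul hQ, Complex.ofReal_re]
  positivity

namespace IsMaximalDarkDim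

lemma darkDefect_le (h : IsMaximalDarkDim μ r) (hP : P ∈ darkProjections (nonzeroPart μ) r)
    (ρ : DensityMatrix d) : darkDefect μ ρ.1 ≤ 1 - (opTrace (P * ρ.1)).re := by
  rw [h.darkDefect_eq_iInf]
  refine ciInf_le (f := fun P : darkProjections (nonzeroPart μ) r => 1 - (opTrace (P.1 * ρ.1)).re)
    ⟨0, ?_⟩ ⟨P, hP⟩
  rintro _ ⟨Q, rfl⟩
  exact one_sub_opTrace_nonneg ρ Q.2.1

lemma darkDefect_nonneg (h : IsMaximalDarkDim μ r) (ρ : DensityMatrix d) :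
    0 ≤ darkDefect μ ρ.1 := by
  rw [h.darkDefect_eq_iInf]
  exact Real.iInf_nonneg fun Q => one_sub_opTrace_nonneg ρ Q.2.1

lemma darkDefect_le_one (h : IsMaximalDarkDim μ r) (ρ : DensityMatrix d) :
    darkDefect μ ρ.1 ≤ 1 := by
  obtain ⟨P, hP⟩ := h.nonempty
  refine (h.darkDefect_le hP ρ).trans (sub_le_self _ ?_)
  obtain ⟨u, hu⟩ := exists_isEnsemble ρ
  rw [hu.opTrace_mul hP.1, Complex.ofReal_re]
  positivity

lemma continuous_opTrace_mul_re :
    Continuous fun p : Op d × Op d => 1 - (opTrace (p.1 * p.2)).re :=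
  continuous_const.sub
    (Complex.continuous_re.comp (continuous_opTrace.comp (by fun_prop)))

lemma exists_darkDefect_eq (h : IsMaximalDarkDim μ r) (ρ : Op d) :
    ∃ P ∈ darkProjections (nonzeroPart μ) r, darkDefect μ ρ = 1 - (opTrace (P * ρ)).re := by
  have hc : Continuous fun P : Op d => 1 - (opTrace (P * ρ)).re := by
    have := continuous_opTrace_mul_re.comp
      (by fun_prop : Continuous fun P : Op d => (P, ρ))
    exact this
  obtain ⟨P, hP, hmin⟩ := isCompact_darkProjections.exists_isMinOn h.nonempty hc.continuousOn
  refine ⟨P, hP, ?_⟩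
  rw [h.darkDefect_eq_iInf]
  have : Nonempty (darkProjections (nonzeroPart μ) r) := ⟨⟨P, hP⟩⟩
  refine le_antisymm (ciInf_le (f := fun P : darkProjections (nonzeroPart μ) r =>
    1 - (opTrace (P.1 * ρ)).re) ⟨1 - (opTrace (P * ρ)).re, ?_⟩ ⟨P, hP⟩) (le_ciInf fun Q => hmin Q.2)
  rintro _ ⟨Q, rfl⟩
  exact hmin Q.2

lemma measurable_darkDefect (h : IsMaximalDarkDim μ r) : Measurable (darkDefect μ) := by
  have : darkDefect μ = fun ρ => ⨅ P : darkProjections (nonzeroPart μ) r,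
      (1 - (opTrace (P.1 * ρ)).re) := funext h.darkDefect_eq_iInf
  rw [this]
  refine UpperSemicontinuous.measurable (upperSemicontinuous_ciInf (fun ρ => ?_) fun P => ?_)
  · have hc : Continuous fun P : Op d => 1 - (opTrace (P * ρ)).re := by
      have := continuous_opTrace_mul_re.comp
        (by fun_prop : Continuous fun P : Op d => (P, ρ))
      exact this
    refine (isCompact_darkProjections (m := nonzeroPart μ) (r := r)).bddBelow_image
      hc.continuousOn |>.mono ?_
    rintro _ ⟨Q, rfl⟩
    exact ⟨Q, Q.2, rfl⟩
  · have := continuous_opTrace_mul_re.comp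
      (by fun_prop : Continuous fun ρ : Op d => (P.1, ρ))
    exact Continuous.upperSemicontinuous this

end IsMaximalDarkDim

lemma sqrt_sum_norm_add_sq_le (a b : Fin d → Hilb d) :
    Real.sqrt (∑ i, ‖a i + b i‖ ^ 2) ≤
      Real.sqrt (∑ i, ‖a i‖ ^ 2) + Real.sqrt (∑ i, ‖b i‖ ^ 2) := by
  have h := norm_add_le (WithLp.toLp 2 a : PiLp 2 fun _ : Fin d => Hilb d) (WithLp.toLp 2 b)
  simpa [PiLp.norm_eq_of_L2] using h

/-- The square root of the defect, as an extended nonnegative number. It is the quantity that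
contracts: the defect itself need not decrease on average near the dark subspaces. -/
noncomputable def rootDefect (μ : Measure (Op d)) (ρ : DensityMatrix d) : ℝ≥0∞ :=
  ENNReal.ofReal (Real.sqrt (darkDefect μ ρ.1))

namespace IsMaximalDarkDim

lemma measurable_rootDefect (h : IsMaximalDarkDim μ r) : Measurable (rootDefect μ) :=
  ENNReal.measurable_ofReal.comp (Real.continuous_sqrt.measurable.comp
    (h.measurable_darkDefect.comp measurable_subtype_coe))

lemma sqrt_darkDefect_le_one (h : IsMaximalDarkDim μ r) (ρ : DensityMatrix d) :
    Real.sqrt (darkDefect μ ρ.1) ≤ 1 := Real.sqrt_le_one.2 (h.darkDefect_le_one ρ)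

/-- Pointwise form of the contraction estimate: after the outcome `W`, the state is compared with
the image under `W` of the dark subspace of `P`. -/
lemma sqrt_darkDefect_updateState_mul_le (h : IsMaximalDarkDim μ r) (hu : IsEnsemble u ρ)
    (hP : IsStarProjection P) {W : Op d} (hW : IsConformalOn P W)
    (hI : W * P ≠ 0 → imageProj P W ∈ darkProjections (nonzeroPart μ) r) :
    Real.sqrt (darkDefect μ (updateState ρ W).1) * outcomeDensity ρ W ≤
      ∑ i, angleDefect W P ((1 - P) (u i)) + ∑ i, ‖W ((1 - P) (u i))‖ ^ 2 := by
  set e : Fin d → Hilb d := fun i => (1 - P) (u i) with he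
  have hsplit : ∀ i, W (u i) = W (P (u i)) + W (e i) := fun i => by
    rw [← map_add, he]
    simp
  have hnn : 0 ≤ ∑ i, angleDefect W P (e i) :=
    Finset.sum_nonneg fun i _ => angleDefect_nonneg _ _ _
  by_cases h0 : W * P = 0
  · have h1 : ∀ i, W (u i) = W (e i) := fun i => by
      rw [hsplit, show W (P (u i)) = (W * P) (u i) from rfl, h0]
      simp
    have h2 : outcomeDensity ρ W = ∑ i, ‖W (e i)‖ ^ 2 := by
      rw [hu.outcomeDensity_eq]
      simp_rw [h1]
    have h3 := mul_le_mul_of_nonneg_right (h.sqrt_darkDefect_le_one (updateState ρ W))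
      (outcomeDensity_nonneg ρ W)
    linarith
  by_cases ht : outcomeDensity ρ W = 0
  · rw [ht, mul_zero]
    positivity
  have hQ := (hI h0).1
  have htpos : 0 < outcomeDensity ρ W := lt_of_le_of_ne (outcomeDensity_nonneg ρ W) (Ne.symm ht)
  set Q := imageProj P W with hQdef
  set A : ℝ := ∑ i, ‖(1 - Q) (W (e i))‖ ^ 2 with hA
  set B : ℝ := ∑ i, ‖W (e i)‖ ^ 2 with hB
  have hA0 : 0 ≤ A := by positivity
  have hAB : A ≤ B := Finset.sum_le_sum fun i _ => by
    rw [hQ.norm_sub_apply_sq]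
    exact sub_le_self _ (sq_nonneg _)
  -- The defect of the new state is at most `A / outcomeDensity ρ W`.
  have h1 : darkDefect μ (updateState ρ W).1 * outcomeDensity ρ W ≤ A := by
    have h2 := h.darkDefect_le (hI h0) (updateState ρ W)
    have hre : (opTrace (Q * (updateState ρ W).1)).re =
        (outcomeDensity ρ W)⁻¹ * ∑ i, ‖Q (W (u i))‖ ^ 2 := by
      rw [updateState_val ht, mul_smul_comm, opTrace_smul, hu.opTrace_mul_conj hQ,
        ← Complex.ofReal_inv, ← Complex.ofReal_mul, Complex.ofReal_re]
    rw [hre] at h2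
    have h3 : ∀ i, ‖(1 - Q) (W (e i))‖ ^ 2 = ‖W (u i)‖ ^ 2 - ‖Q (W (u i))‖ ^ 2 := fun i => by
      have h4 : (1 - Q) (W (P (u i))) = 0 := by
        have : (1 - Q) * (W * P) = 0 := by
          rw [sub_mul, one_mul, imageProj_mul hP hW h0, sub_self]
        exact DFunLike.congr_fun this (u i)
      rw [← hQ.norm_sub_apply_sq, hsplit, map_add, h4, zero_add]
    rw [hA]
    simp_rw [h3]
    rw [Finset.sum_sub_distrib, ← hu.outcomeDensity_eq]
    calc _ ≤ (1 - (outcomeDensity ρ W)⁻¹ * ∑ i, ‖Q (W (u i))‖ ^ 2) * outcomeDensity ρ W := by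
          gcongr
      _ = _ := by field_simp
  have h5 : Real.sqrt (darkDefect μ (updateState ρ W).1) * outcomeDensity ρ W ≤
      Real.sqrt A * Real.sqrt (outcomeDensity ρ W) := by
    have h6 := Real.sqrt_le_sqrt h1
    rw [Real.sqrt_mul (h.darkDefect_nonneg _)] at h6
    calc _ = Real.sqrt (darkDefect μ (updateState ρ W).1) * Real.sqrt (outcomeDensity ρ W) *
          Real.sqrt (outcomeDensity ρ W) := by
            rw [mul_assoc, Real.mul_self_sqrt htpos.le]
      _ ≤ _ := by gcongr
  have h7 : Real.sqrt (outcomeDensity ρ W) ≤ ‖W * P‖ + Real.sqrt B := by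
    rw [hu.outcomeDensity_eq]
    simp_rw [hsplit]
    refine (sqrt_sum_norm_add_sq_le _ _).trans ?_
    gcongr
    refine Real.sqrt_le_iff.2 ⟨norm_nonneg _, ?_⟩
    calc ∑ i, ‖W (P (u i))‖ ^ 2 ≤ ∑ i, (‖W * P‖ * ‖u i‖) ^ 2 := by
          gcongr with i
          exact (W * P).le_opNorm (u i)
      _ = ‖W * P‖ ^ 2 := by
          simp_rw [mul_pow]
          rw [← Finset.mul_sum, hu.sum_norm_sq, mul_one]
  have h8 : ‖W * P‖ * Real.sqrt A ≤ ∑ i, angleDefect W P (e i) := by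
    simp_rw [angleDefect_eq hP hW h0, ← Finset.mul_sum]
    gcongr
    refine Real.sqrt_le_iff.2 ⟨by positivity, ?_⟩
    exact Finset.sum_sq_le_sq_sum_of_nonneg fun i _ => norm_nonneg _
  calc _ ≤ Real.sqrt A * (‖W * P‖ + Real.sqrt B) := h5.trans (by gcongr)
    _ = ‖W * P‖ * Real.sqrt A + Real.sqrt A * Real.sqrt B := by ring
    _ ≤ ‖W * P‖ * Real.sqrt A + Real.sqrt B * Real.sqrt B := by gcongr
    _ = ‖W * P‖ * Real.sqrt A + B := by rw [Real.mul_self_sqrt (by positivity)]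
    _ ≤ _ := by gcongr

end IsMaximalDarkDim

end Defect

/-! ### Reaching the dark subspaces by irreducibility -/

section Reaching

variable {d : ℕ} {m : Measure (Op d)} {P : Op d}

lemma IsIrreducibleMeasure.nonzeroPart {μ : Measure (Op d)} (h : IsIrreducibleMeasure μ) :
    IsIrreducibleMeasure (nonzeroPart μ) := fun E hE =>
  h E (ae_of_ae_nonzeroPart (p := fun v => ∀ x ∈ E, v x ∈ E) (fun _ _ => E.zero_mem) hE)

/-- The vectors that are sent to the kernel of `P` by almost every product of outcomes. -/
def neverReaching (m : Measure (Op d)) (P : Op d) : Submodule ℂ (Hilb d) where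
  carrier := {x | ∀ n, ∀ᵐ W ∂(productLaw m n), P (W x) = 0}
  zero_mem' := fun n => .of_forall fun W => by rw [map_zero, map_zero]
  add_mem' := fun {x y} hx hy n => by
    filter_upwards [hx n, hy n] with W h1 h2
    rw [map_add, map_add, h1, h2, add_zero]
  smul_mem' := fun c x hx n => by
    filter_upwards [hx n] with W h1
    rw [map_smul, map_smul, h1, smul_zero]

lemma neverReaching_eq_bot [SFinite m] (hirr : IsIrreducibleMeasure m) (hP : P ≠ 0) :
    neverReaching m P = ⊥ := by
  refine (hirr _ ?_).resolve_right fun htop => hP ?_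
  · obtain ⟨s, hs⟩ := IsNoetherian.noetherian (neverReaching m P)
    have h1 : ∀ x ∈ neverReaching m P, ∀ᵐ v ∂m, v x ∈ neverReaching m P := by
      intro x hx
      have : ∀ n, ∀ᵐ v ∂m, ∀ᵐ W ∂(productLaw m n), P (W (v x)) = 0 := fun n => by
        have h2 := (ae_productLaw_add n 1 (p := fun W => P (W x) = 0)
          (isClosed_eq (by fun_prop) continuous_const).measurableSet).1 (hx (n + 1))
        rwa [productLaw_one] at h2
      exact ae_all_iff.2 this
    have h2 : ∀ᵐ v ∂m, ∀ x ∈ s, v x ∈ neverReaching m P :=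
      (ae_ball_iff s.countable_toSet).2 fun x hx => h1 x (hs ▸ Submodule.subset_span hx)
    filter_upwards [h2] with v hv x hx
    have h3 : neverReaching m P ≤ (neverReaching m P).comap v.toLinearMap := by
      conv_lhs => rw [← hs]
      exact Submodule.span_le.2 hv
    exact h3 hx
  · ext1 x
    have hx : x ∈ neverReaching m P := htop ▸ Submodule.mem_top
    have := hx 0
    rw [productLaw, ae_dirac_iff (isClosed_eq (by fun_prop) continuous_const).measurableSet] at this
    exact this

lemma norm_apply_apply_sq_le (hP : ‖P‖ ≤ 1) (W : Op d) (x : Hilb d) :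
    ‖P (W x)‖ ^ 2 ≤ ‖W‖ ^ 2 * ‖x‖ ^ 2 := by
  rw [← mul_pow]
  gcongr
  calc ‖P (W x)‖ ≤ ‖P‖ * ‖W x‖ := P.le_opNorm _
    _ ≤ 1 * ‖W x‖ := by gcongr
    _ ≤ ‖W‖ * ‖x‖ := by rw [one_mul]; exact W.le_opNorm x

lemma integrable_norm_apply_apply_sq [SFinite m] (hmom : ∫⁻ v, ENNReal.ofReal ‖v‖ ^ 2 ∂m < ⊤)
    (hP : ‖P‖ ≤ 1) (k : ℕ) (x : Hilb d) :
    Integrable (fun W : Op d => ‖P (W x)‖ ^ 2) (productLaw m k) :=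
  ((integrable_norm_sq_productLaw hmom k).mul_const (‖x‖ ^ 2)).mono' (by fun_prop)
    (.of_forall fun W => by
      rw [Real.norm_of_nonneg (by positivity)]
      exact norm_apply_apply_sq_le hP W x)

/-- Uniformly over the unit vectors `x`, the dark subspace is reached from `x` within a bounded
number of steps. -/
lemma exists_sum_integral_ge [SFinite m] (hmom : ∫⁻ v, ENNReal.ofReal ‖v‖ ^ 2 ∂m < ⊤)
    (hirr : IsIrreducibleMeasure m) (hP : P ≠ 0) (hP1 : ‖P‖ ≤ 1) :
    ∃ K : ℕ, ∃ η : ℝ, 0 < η ∧ ∀ x : Hilb d,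
      η * ‖x‖ ^ 2 ≤ ∑ k ∈ Finset.range K, ∫ W, ‖P (W x)‖ ^ 2 ∂(productLaw m k) := by
  set g : ℕ → Hilb d → ℝ := fun k x => ∫ W, ‖P (W x)‖ ^ 2 ∂(productLaw m k) with hg
  have hint := integrable_norm_apply_apply_sq hmom hP1
  have hg0 : ∀ k x, 0 ≤ g k x := fun k x => integral_nonneg fun W => by positivity
  have hgc : ∀ k, ContinuousOn (g k) (Metric.sphere 0 1) := fun k => by
    refine continuousOn_of_dominated (bound := fun W => ‖W‖ ^ 2) (fun x _ => by fun_prop)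
      (fun x hx => .of_forall fun W => ?_) (integrable_norm_sq_productLaw hmom k)
      (.of_forall fun W => by fun_prop)
    rw [Real.norm_of_nonneg (by positivity)]
    refine (norm_apply_apply_sq_le hP1 W x).trans_eq ?_
    rw [mem_sphere_zero_iff_norm.1 hx, one_pow, mul_one]
  have hpos : ∀ x ∈ Metric.sphere (0 : Hilb d) 1, ∃ k, 0 < g k x := by
    intro x hx
    by_contra! hcon
    have hmem : x ∈ neverReaching m P := fun k => by
      have h0 := le_antisymm (hcon k) (hg0 k x)
      rw [hg, integral_eq_zero_iff_of_nonneg (fun W => by positivity) (hint k x)] at h0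
      filter_upwards [h0] with W hW
      simpa using hW
    rw [neverReaching_eq_bot hirr hP, Submodule.mem_bot] at hmem
    rw [hmem] at hx
    simp at hx
  have hGc : ∀ K, ContinuousOn (fun x => ∑ k ∈ Finset.range K, g k x) (Metric.sphere 0 1) :=
    fun K => continuousOn_finsetSum _ fun k _ => hgc k
  obtain ⟨K, hK⟩ : ∃ K, ∀ x ∈ Metric.sphere (0 : Hilb d) 1,
      0 < ∑ k ∈ Finset.range K, g k x := by
    by_contra! hcon
    have hclosed : ∀ K, IsClosed {x ∈ Metric.sphere (0 : Hilb d) 1 |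
        ∑ k ∈ Finset.range K, g k x ≤ 0} := fun K =>
      (hGc K).preimage_isClosed_of_isClosed Metric.isClosed_sphere isClosed_Iic
    obtain ⟨x, hx⟩ := IsCompact.nonempty_iInter_of_sequence_nonempty_isCompact_isClosed
      (fun K => {x ∈ Metric.sphere (0 : Hilb d) 1 | ∑ k ∈ Finset.range K, g k x ≤ 0})
      (fun K x hx => ⟨hx.1, le_trans (by
        rw [Finset.sum_range_succ]; exact le_add_of_nonneg_right (hg0 K x)) hx.2⟩)
      (fun K => let ⟨x, hx, h⟩ := hcon K; ⟨x, hx, h⟩)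
      ((isCompact_sphere _ _).of_isClosed_subset (hclosed 0) fun q hq => hq.1) hclosed
    rw [Set.mem_iInter] at hx
    obtain ⟨k, hk⟩ := hpos x (hx 0).1
    have h1 : g k x ≤ ∑ j ∈ Finset.range (k + 1), g j x :=
      Finset.single_le_sum (fun j _ => hg0 j x) (Finset.self_mem_range_succ k)
    exact absurd (h1.trans (hx (k + 1)).2) (not_le.2 hk)
  obtain ⟨η, hη, hηle⟩ : ∃ η : ℝ, 0 < η ∧ ∀ x ∈ Metric.sphere (0 : Hilb d) 1,
      η ≤ ∑ k ∈ Finset.range K, g k x := by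
    rcases (Metric.sphere (0 : Hilb d) 1).eq_empty_or_nonempty with h | h
    · exact ⟨1, one_pos, by simp [h]⟩
    · obtain ⟨x, hx, hmin⟩ := (isCompact_sphere (0 : Hilb d) 1).exists_isMinOn h (hGc K)
      exact ⟨_, hK x hx, fun y hy => hmin hy⟩
  refine ⟨K, η, hη, fun x => ?_⟩
  by_cases hx : x = 0
  · rw [hx, norm_zero]
    simp
  · have hn : ‖x‖ ≠ 0 := norm_ne_zero_iff.2 hx
    have h1 := hηle ((‖x‖ : ℂ)⁻¹ • x) (by
      rw [mem_sphere_zero_iff_norm, norm_smul, norm_inv, Complex.norm_real, norm_norm,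
        inv_mul_cancel₀ hn])
    have h2 : ∀ k, g k ((‖x‖ : ℂ)⁻¹ • x) = (‖x‖ ^ 2)⁻¹ * g k x := fun k => by
      simp_rw [hg, map_smul, norm_smul, norm_inv, Complex.norm_real, norm_norm, mul_pow, inv_pow]
      rw [integral_const_mul]
    simp_rw [h2] at h1
    rw [← Finset.mul_sum, le_inv_mul_iff₀ (by positivity)] at h1
    linarith

/-- From any state, some step `k < K` has mean overlap at least `η` with the dark subspace. -/
lemma exists_evolve_overlap_ge [SFinite m] (hmom : ∫⁻ v, ENNReal.ofReal ‖v‖ ^ 2 ∂m < ⊤)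
    (hirr : IsIrreducibleMeasure m) (hP : P ≠ 0) (hPs : IsStarProjection P) :
    ∃ K : ℕ, ∃ η : ℝ, 0 < η ∧ ∀ ρ : DensityMatrix d, ∃ k < K,
      ENNReal.ofReal η ≤ evolve m k (fun ρ => ENNReal.ofReal (opTrace (P * ρ.1)).re) ρ := by
  obtain ⟨K, η, hη, h⟩ := exists_sum_integral_ge hmom hirr hP hPs.norm_le
  have hint := integrable_norm_apply_apply_sq hmom hPs.norm_le
  have key : ∀ (k : ℕ) (ρ : DensityMatrix d) (u : Fin d → Hilb d), IsEnsemble u ρ →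
      evolve m k (fun ρ => ENNReal.ofReal (opTrace (P * ρ.1)).re) ρ =
        ENNReal.ofReal (∑ i, ∫ W, ‖P (W (u i))‖ ^ 2 ∂(productLaw m k)) := by
    intro k ρ u hu
    rw [← integral_finsetSum _ fun i _ => hint k (u i),
      ofReal_integral_eq_lintegral_ofReal (integrable_finsetSum _ fun i _ => hint k (u i))
        (.of_forall fun W => Finset.sum_nonneg fun i _ => sq_nonneg _)]
    refine lintegral_congr fun W => ?_
    by_cases hW : outcomeDensity ρ W = 0
    · have h0 := hW
      rw [hu.outcomeDensity_eq, Finset.sum_eq_zero_iff_of_nonneg fun i _ => sq_nonneg _] at h0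
      have h1 : ∑ i, ‖P (W (u i))‖ ^ 2 = 0 := Finset.sum_eq_zero fun i hi => by
        have : W (u i) = 0 := by simpa using h0 i hi
        rw [this, map_zero, norm_zero, zero_pow two_ne_zero]
      rw [hW, h1, ENNReal.ofReal_zero, mul_zero]
    · rw [← ENNReal.ofReal_mul (opTrace_mul_re_nonneg _ hPs), updateState_val hW, mul_smul_comm,
        opTrace_smul, hu.opTrace_mul_conj hPs, ← Complex.ofReal_inv, ← Complex.ofReal_mul,
        Complex.ofReal_re, mul_comm, mul_inv_cancel_left₀ hW]
  have hsum : ∀ (ρ : DensityMatrix d) (u : Fin d → Hilb d), IsEnsemble u ρ →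
      η ≤ ∑ k ∈ Finset.range K, ∑ i, ∫ W, ‖P (W (u i))‖ ^ 2 ∂(productLaw m k) := by
    intro ρ u hu
    rw [Finset.sum_comm]
    calc η = ∑ i, η * ‖u i‖ ^ 2 := by rw [← Finset.mul_sum, hu.sum_norm_sq, mul_one]
      _ ≤ _ := Finset.sum_le_sum fun i _ => h (u i)
  -- If `K = 0`, then `hsum` shows that there is no state at all, and any constant will do.
  rcases Nat.eq_zero_or_pos K with hK | hK
  · refine ⟨K, η, hη, fun ρ => ?_⟩
    obtain ⟨u, hu⟩ := exists_isEnsemble ρ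
    have := hsum ρ u hu
    rw [hK, Finset.sum_range_zero] at this
    exact absurd this (not_le.2 hη)
  · refine ⟨K, η / K, by positivity, fun ρ => ?_⟩
    obtain ⟨u, hu⟩ := exists_isEnsemble ρ
    obtain ⟨k, hk, hle⟩ := Finset.exists_le_of_sum_le (s := Finset.range K)
      (f := fun _ => η / K)
      (g := fun k => ∑ i, ∫ W, ‖P (W (u i))‖ ^ 2 ∂(productLaw m k))
      (Finset.nonempty_range_iff.2 hK.ne') (by
        rw [Finset.sum_const, Finset.card_range, nsmul_eq_mul, mul_div_cancel₀]
        · exact hsum ρ u hu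
        · exact_mod_cast hK.ne')
    exact ⟨k, Finset.mem_range.1 hk, by rw [key k ρ u hu]; exact ENNReal.ofReal_le_ofReal hle⟩

end Reaching

/-! ### Contraction of the root defect -/

section Contraction

variable {d : ℕ} {μ : Measure (Op d)} {r : ℕ} {ρ : DensityMatrix d} {P : Op d}

/-- The estimate `E^ρ[√Q(ρₙ)] ≤ ε d s + s²`, with `s² = 1 - tr (P ρ)` and `ε` a bound on the mean
defect after `n` steps. It serves for `P` optimal as well as for a fixed `P`. -/
lemma IsMaximalDarkDim.evolve_rootDefect_le [SigmaFinite (nonzeroPart μ)]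
    (h : IsMaximalDarkDim μ r)
    (hm : ∀ x : Hilb d, ∫⁻ v, ‖v x‖ₑ ^ 2 ∂(nonzeroPart μ) = ‖x‖ₑ ^ 2) {n : ℕ} {ε : ℝ}
    (hε : 0 ≤ ε) (hκ : ∀ P ∈ darkProjections (nonzeroPart μ) r, ∀ e, P e = 0 →
      meanDefect (nonzeroPart μ) n P e ≤ ENNReal.ofReal ε * ‖e‖ₑ)
    (hP : P ∈ darkProjections (nonzeroPart μ) r) (ρ : DensityMatrix d) :
    evolve (nonzeroPart μ) n (rootDefect μ) ρ ≤
      ENNReal.ofReal (ε * (d * Real.sqrt (1 - (opTrace (P * ρ.1)).re)) +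
        (1 - (opTrace (P * ρ.1)).re)) := by
  obtain ⟨u, hu⟩ := exists_isEnsemble ρ
  rw [hu.one_sub_opTrace hP.1]
  set e : Fin d → Hilb d := fun i => (1 - P) (u i) with he
  have hPe : ∀ i, P (e i) = 0 := fun i => DFunLike.congr_fun hP.1.mul_one_sub_self (u i)
  have hsq : ∀ x : Hilb d, ENNReal.ofReal (‖x‖ ^ 2) = ‖x‖ₑ ^ 2 := fun x => by
    rw [ENNReal.ofReal_pow (norm_nonneg _), ofReal_norm x]
  have hsum : ∑ i, ‖e i‖ ≤ d * Real.sqrt (∑ i, ‖e i‖ ^ 2) := by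
    calc ∑ i, ‖e i‖ ≤ ∑ _i : Fin d, Real.sqrt (∑ i, ‖e i‖ ^ 2) := by
          refine Finset.sum_le_sum fun i _ => Real.le_sqrt_of_sq_le ?_
          exact Finset.single_le_sum (f := fun i => ‖e i‖ ^ 2) (fun j _ => sq_nonneg _)
            (Finset.mem_univ i)
      _ = _ := by rw [Finset.sum_const, Finset.card_univ, Fintype.card_fin, nsmul_eq_mul]
  calc evolve (nonzeroPart μ) n (rootDefect μ) ρ
      ≤ ∫⁻ W, (∑ i, ENNReal.ofReal (angleDefect W P (e i)) + ∑ i, ‖W (e i)‖ₑ ^ 2)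
          ∂(productLaw (nonzeroPart μ) n) := by
        refine lintegral_mono_ae ?_
        filter_upwards [hP.2.2 n, imageProj_mem_darkProjections hP n] with W hW hI
        rw [rootDefect, ← ENNReal.ofReal_mul (Real.sqrt_nonneg _)]
        refine (ENNReal.ofReal_le_ofReal
          (h.sqrt_darkDefect_updateState_mul_le hu hP.1 hW hI)).trans_eq ?_
        rw [ENNReal.ofReal_add (Finset.sum_nonneg fun i _ => angleDefect_nonneg _ _ _)
          (by positivity), ENNReal.ofReal_sum_of_nonneg fun i _ => angleDefect_nonneg _ _ _,
          ENNReal.ofReal_sum_of_nonneg fun i _ => sq_nonneg _]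
        simp_rw [hsq]
        rfl
    _ = ∑ i, meanDefect (nonzeroPart μ) n P (e i) + ∑ i, ‖e i‖ₑ ^ 2 := by
        rw [lintegral_add_left (Finset.measurable_sum _ fun i _ => measurable_angleDefect P (e i)),
          lintegral_finsetSum _ fun i _ => measurable_angleDefect P (e i),
          lintegral_finsetSum _ (by fun_prop)]
        simp_rw [lintegral_enorm_sq_apply_productLaw hm n]
        rfl
    _ ≤ ∑ i, ENNReal.ofReal ε * ‖e i‖ₑ + ∑ i, ‖e i‖ₑ ^ 2 := by
        gcongr with i
        exact hκ P hP (e i) (hPe i)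
    _ = ENNReal.ofReal (ε * ∑ i, ‖e i‖ + ∑ i, ‖e i‖ ^ 2) := by
        rw [ENNReal.ofReal_add (by positivity) (by positivity), ENNReal.ofReal_mul hε,
          ENNReal.ofReal_sum_of_nonneg fun i _ => norm_nonneg _,
          ENNReal.ofReal_sum_of_nonneg fun i _ => sq_nonneg _, Finset.mul_sum]
        simp_rw [hsq, fun i => ofReal_norm (e i)]
    _ ≤ _ := by gcongr

/-- The two regimes of the contraction: `E` is at most `v ^ 2` up to a small multiple of `v`, which
is enough for `v` away from `1`, and at most `β < 1`, which is enough for `v` close to `1`. -/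
lemma le_mul_of_two_bounds {E v β : ℝ} (hβ0 : 0 ≤ β) (hβ1 : β < 1) (hv : 0 ≤ v)
    (h1 : E ≤ (1 - β) / 4 * v + v ^ 2) (h2 : E ≤ β) : E ≤ (3 + β) / 4 * v := by
  by_cases hvβ : v ≤ (1 + β) / 2
  · nlinarith
  · push Not at hvβ
    nlinarith

/-- For some `n`, the `n`-step Markov operator contracts the root defect. -/
lemma IsMaximalDarkDim.exists_contraction [SigmaFinite (nonzeroPart μ)]
    (h : IsMaximalDarkDim μ r)
    (hm : ∀ x : Hilb d, ∫⁻ v, ‖v x‖ₑ ^ 2 ∂(nonzeroPart μ) = ‖x‖ₑ ^ 2)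
    (hmom : ∫⁻ v, ENNReal.ofReal ‖v‖ ^ 2 ∂(nonzeroPart μ) < ⊤)
    (hirr : IsIrreducibleMeasure (nonzeroPart μ)) :
    ∃ n : ℕ, 0 < n ∧ ∃ lam : ℝ, 0 < lam ∧ lam < 1 ∧ ∀ ρ,
      evolve (nonzeroPart μ) n (rootDefect μ) ρ ≤ ENNReal.ofReal lam * rootDefect μ ρ := by
  obtain ⟨P₀, hP₀⟩ := h.nonempty
  have hP₀0 : P₀ ≠ 0 := fun h0 => by
    have := hP₀.2.1
    rw [h0, opTrace_zero] at this
    exact h.pos.ne (by exact_mod_cast this)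
  obtain ⟨K, η', hη', hreach'⟩ := exists_evolve_overlap_ge hmom hirr hP₀0 hP₀.1
  obtain ⟨η, hη, hη1, hηη'⟩ : ∃ η : ℝ, 0 < η ∧ η ≤ 1 ∧ η ≤ η' :=
    ⟨min η' 1, by positivity, min_le_right _ _, min_le_left _ _⟩
  -- `β` bounds the mean root defect from any state, and `ε` is a mean defect small enough, even
  -- after multiplication by `d`, for both regimes of `le_mul_of_two_bounds`.
  set β : ℝ := 1 - η / 2 with hβ
  set ε : ℝ := (1 - β) / 4 / (d + 1) with hε
  have hε0 : 0 < ε := div_pos (by linarith) (by positivity)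
  have hεd : ε * d ≤ (1 - β) / 4 := by
    have h1 : ε * (d + 1) = (1 - β) / 4 := by rw [hε]; field_simp
    linarith
  obtain ⟨N, hN⟩ := exists_forall_meanDefect_le hm hmom h.pos h.succ_eq_empty
    (ε := ENNReal.ofReal ε) (by simpa using hε0)
  have hbound : ∀ n ≥ N, ∀ P ∈ darkProjections (nonzeroPart μ) r, ∀ ρ : DensityMatrix d,
      evolve (nonzeroPart μ) n (rootDefect μ) ρ ≤
        ENNReal.ofReal ((1 - β) / 4 * Real.sqrt (1 - (opTrace (P * ρ.1)).re) +
          (1 - (opTrace (P * ρ.1)).re)) := by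
    intro n hn P hP ρ
    refine (h.evolve_rootDefect_le hm hε0.le (hN n hn) hP ρ).trans (ENNReal.ofReal_le_ofReal ?_)
    rw [← mul_assoc]
    gcongr
  have hmeas : Measurable fun ρ : DensityMatrix d =>
      ENNReal.ofReal (1 - (opTrace (P₀ * ρ.1)).re) := by
    have hc : Continuous fun ρ : DensityMatrix d => 1 - (opTrace (P₀ * ρ.1)).re :=
      continuous_const.sub (Complex.continuous_re.comp (continuous_opTrace.comp (by fun_prop)))
    exact ENNReal.measurable_ofReal.comp hc.measurable
  refine ⟨N + K + 1, by omega, (3 + β) / 4, by linarith, by linarith, fun ρ => ?_⟩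
  have hfar : evolve (nonzeroPart μ) (N + K + 1) (rootDefect μ) ρ ≤ ENNReal.ofReal β := by
    obtain ⟨k, hkK, hk⟩ := hreach' ρ
    have htot : evolve (nonzeroPart μ) k
          (fun ρ => ENNReal.ofReal (1 - (opTrace (P₀ * ρ.1)).re)) ρ +
        evolve (nonzeroPart μ) k (fun ρ => ENNReal.ofReal (opTrace (P₀ * ρ.1)).re) ρ = 1 := by
      rw [← evolve_add_left hmeas, ← evolve_const hm k 1 ρ]
      congr 1
      funext ρ
      rw [← ENNReal.ofReal_add (one_sub_opTrace_nonneg ρ hP₀.1) (opTrace_mul_re_nonneg ρ hP₀.1),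
        sub_add_cancel, ENNReal.ofReal_one]
    have hle : evolve (nonzeroPart μ) k
        (fun ρ => ENNReal.ofReal (1 - (opTrace (P₀ * ρ.1)).re)) ρ ≤ ENNReal.ofReal (1 - η) := by
      rw [ENNReal.ofReal_sub _ hη.le, ENNReal.ofReal_one, ← htot]
      refine ENNReal.le_sub_of_add_le_right ENNReal.ofReal_ne_top ?_
      gcongr
      exact (ENNReal.ofReal_le_ofReal hηη').trans hk
    rw [show N + K + 1 = (N + K + 1 - k) + k by omega, evolve_add h.measurable_rootDefect]
    calc _ ≤ evolve (nonzeroPart μ) k (fun ρ => ENNReal.ofReal ((1 - β) / 4) +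
            ENNReal.ofReal (1 - (opTrace (P₀ * ρ.1)).re)) ρ := by
          refine evolve_mono (fun ρ => ?_) k ρ
          refine (hbound (N + K + 1 - k) (by omega) P₀ hP₀ ρ).trans ?_
          rw [← ENNReal.ofReal_add (by linarith) (one_sub_opTrace_nonneg ρ hP₀.1)]
          gcongr
          refine mul_le_of_le_one_right (by linarith) (Real.sqrt_le_one.2 ?_)
          exact sub_le_self _ (opTrace_mul_re_nonneg ρ hP₀.1)
      _ ≤ ENNReal.ofReal ((1 - β) / 4) + ENNReal.ofReal (1 - η) := by
          rw [evolve_add_left measurable_const, evolve_const hm]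
          gcongr
      _ ≤ ENNReal.ofReal β := by
          rw [← ENNReal.ofReal_add (by linarith) (by linarith)]
          exact ENNReal.ofReal_le_ofReal (by linarith)
  obtain ⟨P, hP, hPρ⟩ := h.exists_darkDefect_eq ρ.1
  have hnear := hbound (N + K + 1) (by omega) P hP ρ
  rw [← hPρ] at hnear
  rw [rootDefect, ← ENNReal.ofReal_mul (by linarith)]
  have hfin := (hfar.trans_lt ENNReal.ofReal_lt_top).ne
  rw [← ENNReal.ofReal_toReal hfin] at hfar hnear ⊢
  rw [ENNReal.ofReal_le_ofReal_iff (by linarith)] at hfar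
  have hv : 0 ≤ darkDefect μ ρ.1 := h.darkDefect_nonneg ρ
  rw [ENNReal.ofReal_le_ofReal_iff (by
    have : 0 ≤ 1 - β := by linarith
    positivity)] at hnear
  refine ENNReal.ofReal_le_ofReal (le_mul_of_two_bounds (by linarith) (by linarith)
    (Real.sqrt_nonneg _) ?_ hfar)
  rwa [Real.sq_sqrt hv]

lemma IsMaximalDarkDim.exists_evolve_rootDefect_le_pow [SigmaFinite (nonzeroPart μ)]
    (h : IsMaximalDarkDim μ r)
    (hm : ∀ x : Hilb d, ∫⁻ v, ‖v x‖ₑ ^ 2 ∂(nonzeroPart μ) = ‖x‖ₑ ^ 2)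
    (hmom : ∫⁻ v, ENNReal.ofReal ‖v‖ ^ 2 ∂(nonzeroPart μ) < ⊤)
    (hirr : IsIrreducibleMeasure (nonzeroPart μ)) :
    ∃ C lam : ℝ, 0 < C ∧ 0 < lam ∧ lam < 1 ∧ ∀ n ρ,
      evolve (nonzeroPart μ) n (rootDefect μ) ρ ≤ ENNReal.ofReal (C * lam ^ n) := by
  obtain ⟨p, hp, lam, hl0, hl1, hcon⟩ := h.exists_contraction hm hmom hirr
  have hV := h.measurable_rootDefect
  have hpow : ∀ j ρ, evolve (nonzeroPart μ) (p * j) (rootDefect μ) ρ ≤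
      ENNReal.ofReal lam ^ j * rootDefect μ ρ := by
    intro j
    induction j with
    | zero => intro ρ; rw [mul_zero, evolve_zero hV, pow_zero, one_mul]
    | succ j ih =>
      intro ρ
      rw [mul_add, mul_one, evolve_add hV]
      calc _ ≤ evolve (nonzeroPart μ) p
            (fun ρ => ENNReal.ofReal lam ^ j * rootDefect μ ρ) ρ := evolve_mono ih p ρ
        _ = ENNReal.ofReal lam ^ j * evolve (nonzeroPart μ) p (rootDefect μ) ρ :=
          evolve_const_mul hV _ _ _
        _ ≤ ENNReal.ofReal lam ^ j * (ENNReal.ofReal lam * rootDefect μ ρ) := by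
          gcongr; exact hcon ρ
        _ = _ := by rw [pow_succ, mul_assoc]
  have hp' : (0 : ℝ) < p := by exact_mod_cast hp
  refine ⟨lam⁻¹, lam ^ (1 / p : ℝ), by positivity, by positivity,
    Real.rpow_lt_one hl0.le hl1 (by positivity), fun n ρ => ?_⟩
  calc evolve (nonzeroPart μ) n (rootDefect μ) ρ
      = evolve (nonzeroPart μ) (n % p)
          (evolve (nonzeroPart μ) (p * (n / p)) (rootDefect μ)) ρ := by
        rw [← evolve_add hV, Nat.div_add_mod]
    _ ≤ evolve (nonzeroPart μ) (n % p) (fun _ => ENNReal.ofReal lam ^ (n / p)) ρ := by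
        refine evolve_mono (fun ρ => (hpow (n / p) ρ).trans ?_) _ ρ
        refine mul_le_of_le_one_right' ?_
        rw [rootDefect, ENNReal.ofReal_le_one]
        exact h.sqrt_darkDefect_le_one ρ
    _ = ENNReal.ofReal (lam ^ (n / p)) := by
        rw [evolve_const hm, ENNReal.ofReal_pow hl0.le]
    _ ≤ _ := by
        refine ENNReal.ofReal_le_ofReal ?_
        rw [le_inv_mul_iff₀ hl0, ← pow_succ', ← Real.rpow_natCast, ← Real.rpow_natCast,
          ← Real.rpow_mul hl0.le]
        refine Real.rpow_le_rpow_of_exponent_ge hl0 hl1.le ?_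
        rw [one_div_mul_eq_div, div_le_iff₀ hp']
        have h1 : n < (n / p + 1) * p := by
          have := Nat.lt_mul_div_succ n hp
          linarith
        exact_mod_cast h1.le

end Contraction

/-! ### The law of the quantum trajectory -/

section Chain

variable {d : ℕ} {μ : Measure (Op d)}

lemma lintegral_outcomeStep {f : Op d → ℝ≥0∞} (hf : Measurable f) (ρ : DensityMatrix d) :
    ∫⁻ v, f v ∂(outcomeStep μ ρ) =
      ∫⁻ v, f v * ENNReal.ofReal (outcomeDensity ρ v) ∂(nonzeroPart μ) := by
  rw [outcomeStep, lintegral_nonzeroPart]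
  · simp_rw [mul_comm (f _)]
    exact lintegral_withDensity_eq_lintegral_mul μ (measurable_outcomeDensity_right ρ) hf
  · rw [outcomeDensity, zero_mul, zero_mul]
    simp [opTrace_zero]

lemma lintegral_stepKernel (hμ : IsStochastic μ) {G : DensityMatrix d × Op d → ℝ≥0∞}
    (hG : Measurable G) (ρ : DensityMatrix d) :
    ∫⁻ y, G y ∂(stepKernel hμ ρ) = ∫⁻ v, G (updateState ρ v, v) *
      ENNReal.ofReal (outcomeDensity ρ v) ∂(nonzeroPart μ) := by
  have hmeas : Measurable fun p : DensityMatrix d × Op d => (updateState p.1 p.2, p.2) :=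
    measurable_updateState.prodMk measurable_snd
  have : IsMarkovKernel
      (⟨outcomeStep μ, measurable_outcomeStep hμ⟩ : Kernel (DensityMatrix d) (Op d)) :=
    ⟨fun ρ => ⟨outcomeStep_univ hμ ρ⟩⟩
  rw [stepKernel, Kernel.lintegral_map _ hmeas _ hG, Kernel.lintegral_id_prod]
  · exact lintegral_outcomeStep ((hG.comp hmeas).comp (measurable_prodMk_left (x := ρ))) ρ
  · exact hG.comp hmeas

/-- The transition kernels of the chain of pairs (state, last outcome). -/
noncomputable def pairKernel (hμ : IsStochastic μ) (n : ℕ) :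
    Kernel ((i : Finset.Iic n) → DensityMatrix d × Op d) (DensityMatrix d × Op d) :=
  (stepKernel hμ).comap (fun h : (i : Finset.Iic n) → DensityMatrix d × Op d =>
    (h ⟨n, Finset.mem_Iic.2 le_rfl⟩).1) (by fun_prop)

instance (hμ : IsStochastic μ) (n : ℕ) : IsMarkovKernel (pairKernel hμ n) := by
  unfold pairKernel; infer_instance

/-- The law of the chain of pairs (state, last outcome) started at `(ρ, 0)`. -/
noncomputable def pairLaw (hμ : IsStochastic μ) (ρ : DensityMatrix d) :
    Measure (ℕ → DensityMatrix d × Op d) :=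
  Kernel.traj (X := fun _ => DensityMatrix d × Op d) (pairKernel hμ) 0 (fun _ => (ρ, 0))

instance (hμ : IsStochastic μ) (ρ : DensityMatrix d) : IsProbabilityMeasure (pairLaw hμ ρ) := by
  unfold pairLaw; infer_instance

/-- The Markov property of the chain of pairs. -/
lemma lintegral_pairLaw_succ (hμ : IsStochastic μ) (ρ : DensityMatrix d) (n : ℕ)
    {G : (DensityMatrix d × Op d) × (DensityMatrix d × Op d) → ℝ≥0∞} (hG : Measurable G) :
    ∫⁻ x, G (x n, x (n + 1)) ∂(pairLaw hμ ρ) =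
      ∫⁻ x, ∫⁻ y, G (x n, y) ∂(stepKernel hμ (x n).1) ∂(pairLaw hμ ρ) := by
  let X : ℕ → Type := fun _ => DensityMatrix d × Op d
  have hf : Measurable fun x : ℕ → DensityMatrix d × Op d => G (x n, x (n + 1)) := by fun_prop
  have hg : Measurable fun y : DensityMatrix d × Op d =>
      ∫⁻ z, G (y, z) ∂(stepKernel hμ y.1) :=
    Measurable.lintegral_kernel_prod_right'
      (κ := (stepKernel hμ).comap (Prod.fst : DensityMatrix d × Op d → DensityMatrix d)
        measurable_fst) hG
  have h1 : ∀ y : (i : Finset.Iic n) → X i,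
      ∫⁻ x, G (x n, x (n + 1)) ∂(Kernel.traj (X := X) (pairKernel hμ) n y) =
        ∫⁻ z, G (y ⟨n, Finset.mem_Iic.2 le_rfl⟩, z)
          ∂(stepKernel hμ (y ⟨n, Finset.mem_Iic.2 le_rfl⟩).1) := by
    intro y
    rw [Kernel.lintegral_traj (X := X) (κ := pairKernel hμ) y hf]
    have h2 := Kernel.map_traj_succ_self (X := X) (κ := pairKernel hμ) (a := n)
    have h3 : ∫⁻ z, G (y ⟨n, Finset.mem_Iic.2 le_rfl⟩, z) ∂(pairKernel hμ n y) =
        ∫⁻ z, G (y ⟨n, Finset.mem_Iic.2 le_rfl⟩, z)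
          ∂(stepKernel hμ (y ⟨n, Finset.mem_Iic.2 le_rfl⟩).1) := rfl
    rw [← h3, ← h2, Kernel.lintegral_map _ (by fun_prop) _ (by fun_prop)]
    refine lintegral_congr fun x => ?_
    have hn : Function.updateFinset x (Finset.Iic n) y n = y ⟨n, Finset.mem_Iic.2 le_rfl⟩ :=
      dif_pos (Finset.mem_Iic.2 le_rfl)
    have hn1 : Function.updateFinset x (Finset.Iic n) y (n + 1) = x (n + 1) :=
      dif_neg (by simp)
    rw [hn, hn1]
  have hcomp := Kernel.traj_comp_partialTraj (X := X) (κ := pairKernel hμ) (Nat.zero_le n)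
  have hg' : Measurable fun y : (i : Finset.Iic n) → X i =>
      ∫⁻ z, G (y ⟨n, Finset.mem_Iic.2 le_rfl⟩, z)
        ∂(stepKernel hμ (y ⟨n, Finset.mem_Iic.2 le_rfl⟩).1) :=
    hg.comp (measurable_pi_apply _)
  have h4 := Kernel.lintegral_map (Kernel.traj (X := X) (pairKernel hμ) 0)
    (Preorder.measurable_frestrictLe (X := X) n) (fun _ => (ρ, 0)) hg'
  rw [Kernel.traj_map_frestrictLe (X := X) (κ := pairKernel hμ) 0 n] at h4
  calc ∫⁻ x, G (x n, x (n + 1)) ∂(pairLaw hμ ρ)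
      = ∫⁻ y, ∫⁻ x, G (x n, x (n + 1)) ∂(Kernel.traj (X := X) (pairKernel hμ) n y)
          ∂(Kernel.partialTraj (X := X) (pairKernel hμ) 0 n (fun _ => (ρ, 0))) := by
        rw [← Kernel.lintegral_comp _ _ _ hf, hcomp]
        rfl
    _ = _ := (lintegral_congr h1).trans h4

lemma ae_pairLaw_zero (hμ : IsStochastic μ) (ρ : DensityMatrix d) :
    ∀ᵐ x ∂(pairLaw hμ ρ), (x 0).1 = ρ := by
  let X : ℕ → Type := fun _ => DensityMatrix d × Op d
  have h := Kernel.traj_map_frestrictLe_apply (X := X) (κ := pairKernel hμ) 0 0 (fun _ => (ρ, 0))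
  rw [Kernel.partialTraj_self, Kernel.id_apply] at h
  have hms : MeasurableSet {y : (i : Finset.Iic 0) → X i |
      (y ⟨0, Finset.mem_Iic.2 le_rfl⟩).1 = ρ} :=
    (measurable_fst.comp (measurable_pi_apply
      (X := fun _ : Finset.Iic 0 => DensityMatrix d × Op d) _)) (measurableSet_singleton ρ)
  have h1 : ∀ᵐ y ∂((pairLaw hμ ρ).map (Preorder.frestrictLe (π := X) 0)),
      (y ⟨0, Finset.mem_Iic.2 le_rfl⟩).1 = ρ := by
    rw [pairLaw, h, ae_dirac_iff hms]
  exact (ae_map_iff (Preorder.measurable_frestrictLe (X := X) 0).aemeasurable hms).1 h1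

/-- Along almost every path, the states are obtained from one another by the outcomes, whose
densities do not vanish. -/
lemma ae_pairLaw_step (hμ : IsStochastic μ) (ρ : DensityMatrix d) (n : ℕ) :
    ∀ᵐ x ∂(pairLaw hμ ρ), (x (n + 1)).1 = updateState (x n).1 (x (n + 1)).2 ∧
      outcomeDensity (x n).1 (x (n + 1)).2 ≠ 0 := by
  classical
  let S : Set ((DensityMatrix d × Op d) × (DensityMatrix d × Op d)) :=
    {q | q.2.1 = updateState q.1.1 q.2.2 ∧ outcomeDensity q.1.1 q.2.2 ≠ 0}
  have hS : MeasurableSet S := by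
    have h1 : Measurable fun q : (DensityMatrix d × Op d) × (DensityMatrix d × Op d) =>
        updateState q.1.1 q.2.2 :=
      measurable_updateState.comp
        ((measurable_fst.comp measurable_fst).prodMk (measurable_snd.comp measurable_snd))
    have h2 : Measurable fun q : (DensityMatrix d × Op d) × (DensityMatrix d × Op d) =>
        outcomeDensity q.1.1 q.2.2 :=
      measurable_outcomeDensity.comp
        ((measurable_fst.comp measurable_fst).prodMk (measurable_snd.comp measurable_snd))
    exact (measurableSet_eq_fun (measurable_fst.comp measurable_snd) h1).inter
      (measurableSet_eq_fun h2 measurable_const).compl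
  have hG : Measurable (Sᶜ.indicator (fun _ => (1 : ℝ≥0∞))) := measurable_const.indicator hS.compl
  have h := lintegral_pairLaw_succ hμ ρ n hG
  have h0 : ∀ x : DensityMatrix d × Op d,
      ∫⁻ y, Sᶜ.indicator (fun _ => (1 : ℝ≥0∞)) (x, y) ∂(stepKernel hμ x.1) = 0 := by
    intro x
    have hGx : Measurable fun y => Sᶜ.indicator (fun _ => (1 : ℝ≥0∞)) (x, y) :=
      hG.comp measurable_prodMk_left
    rw [lintegral_stepKernel hμ hGx]
    refine lintegral_eq_zero_of_ae_eq_zero (.of_forall fun v => ?_)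
    by_cases hv : outcomeDensity x.1 v = 0
    · simp [hv]
    · have : (x, (updateState x.1 v, v)) ∉ Sᶜ := not_not.2 ⟨rfl, hv⟩
      simp only [Set.indicator_of_notMem this, zero_mul, Pi.zero_apply]
  simp_rw [h0, lintegral_zero] at h
  have hGx : Measurable fun x : ℕ → DensityMatrix d × Op d =>
      Sᶜ.indicator (fun _ => (1 : ℝ≥0∞)) (x n, x (n + 1)) :=
    hG.comp ((measurable_pi_apply n).prodMk (measurable_pi_apply (n + 1)))
  rw [lintegral_eq_zero_iff hGx] at h
  filter_upwards [h] with x hx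
  by_contra hcon
  have : (x n, x (n + 1)) ∈ Sᶜ := hcon
  rw [Set.indicator_of_mem this] at hx
  exact one_ne_zero hx

lemma ae_pairLaw_quantumTrajectory (hμ : IsStochastic μ) (ρ : DensityMatrix d) (n : ℕ) :
    ∀ᵐ x ∂(pairLaw hμ ρ), quantumTrajectory n (ρ, fun i => (x (i + 1)).2) = (x n).1.1 := by
  filter_upwards [ae_pairLaw_zero hμ ρ, ae_all_iff.2 (ae_pairLaw_step hμ ρ)] with x hx0 hx
  have key : ∀ n, outcomeDensity ρ (prodOp n fun i => (x (i + 1)).2) ≠ 0 ∧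
      (x n).1 = updateState ρ (prodOp n fun i => (x (i + 1)).2) := by
    intro n
    induction n with
    | zero =>
      change outcomeDensity ρ 1 ≠ 0 ∧ _ = updateState ρ 1
      rw [outcomeDensity_one, updateState_one, hx0]
      exact ⟨one_ne_zero, rfl⟩
    | succ n ih =>
      obtain ⟨h1, h2⟩ := hx n
      change outcomeDensity ρ ((x (n + 1)).2 * prodOp n fun i => (x (i + 1)).2) ≠ 0 ∧
        _ = updateState ρ ((x (n + 1)).2 * prodOp n fun i => (x (i + 1)).2)
      have h3 : outcomeDensity ρ ((x (n + 1)).2 * prodOp n fun i => (x (i + 1)).2) ≠ 0 := by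
        rw [← outcomeDensity_mul _ ih.1, ← ih.2]
        exact mul_ne_zero h2 ih.1
      refine ⟨h3, ?_⟩
      rw [h1, ih.2, updateState_updateState h3]
  rw [(key n).2, updateState_val (key n).1, ← opTrace_conj_eq]
  rfl

lemma lintegral_pairLaw_state (hμ : IsStochastic μ) (ρ : DensityMatrix d) (n : ℕ)
    {F : DensityMatrix d → ℝ≥0∞} (hF : Measurable F) :
    ∫⁻ x, F (x n).1 ∂(pairLaw hμ ρ) = evolve (nonzeroPart μ) n F ρ := by
  induction n generalizing F with
  | zero =>
    rw [evolve_zero hF, ← mul_one (F ρ), ← measure_univ (μ := pairLaw hμ ρ), ← lintegral_const]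
    refine lintegral_congr_ae ?_
    filter_upwards [ae_pairLaw_zero hμ ρ] with x hx
    rw [hx]
  | succ n ih =>
    have := sigmaFinite_nonzeroPart hμ
    have hG : Measurable fun q : (DensityMatrix d × Op d) × (DensityMatrix d × Op d) =>
        F q.2.1 := by fun_prop
    rw [lintegral_pairLaw_succ hμ ρ n hG, add_comm, evolve_add hF, ← ih (measurable_evolve hF 1)]
    refine lintegral_congr fun x => ?_
    have hF1 : Measurable fun y : DensityMatrix d × Op d => F y.1 := hF.comp measurable_fst
    exact (lintegral_stepKernel hμ hF1 _).trans (by rw [evolve, productLaw_one])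

lemma lintegral_outcomeLaw (hμ : IsStochastic μ) (ρ : DensityMatrix d)
    {H : (ℕ → Op d) → ℝ≥0∞} (hH : Measurable H) :
    ∫⁻ ω, H ω ∂(outcomeLaw hμ ρ) = ∫⁻ x, H (fun i => (x (i + 1)).2) ∂(pairLaw hμ ρ) := by
  rw [outcomeLaw, Kernel.lintegral_map _ (by fun_prop) _ hH]
  rfl

instance (hμ : IsStochastic μ) : IsMarkovKernel (outcomeLaw hμ) := by
  unfold outcomeLaw
  have (n : ℕ) : IsMarkovKernel ((stepKernel hμ).comap
      (fun h : (i : Finset.Iic n) → DensityMatrix d × Op d =>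
        (h ⟨n, Finset.mem_Iic.2 le_rfl⟩).1) (by fun_prop)) := inferInstance
  exact Kernel.IsMarkovKernel.map _ (by fun_prop)

lemma measurable_quantumTrajectory (n : ℕ) :
    Measurable (quantumTrajectory n : DensityMatrix d × (ℕ → Op d) → Op d) := by
  have hW : Continuous fun p : DensityMatrix d × (ℕ → Op d) => prodOp n fun i => p.2 i :=
    (continuous_prodOp n).comp (by fun_prop)
  have hc : Continuous fun p : DensityMatrix d × (ℕ → Op d) =>
      (prodOp n fun i => p.2 i) * p.1.1 * star (prodOp n fun i => p.2 i) :=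
    (hW.mul (continuous_subtype_val.comp continuous_fst)).mul (continuous_star_op.comp hW)
  exact (continuous_opTrace.comp hc).measurable.inv.smul hc.measurable

lemma lintegral_quantumTrajectory (hμ : IsStochastic μ) (ν : Measure (DensityMatrix d))
    [SFinite ν] (n : ℕ) {Φ : Op d → ℝ≥0∞} (hΦ : Measurable Φ) :
    ∫⁻ p, Φ (quantumTrajectory n p) ∂(trajectoryLaw hμ ν) =
      ∫⁻ ρ, evolve (nonzeroPart μ) n (fun ρ => Φ ρ.1) ρ ∂ν := by
  have hmeas := hΦ.comp (measurable_quantumTrajectory (d := d) n)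
  rw [trajectoryLaw]
  refine (Measure.lintegral_compProd hmeas).trans (lintegral_congr fun ρ => ?_)
  refine (lintegral_outcomeLaw hμ ρ (hmeas.comp (measurable_prodMk_left (x := ρ)))).trans ?_
  refine Eq.trans (lintegral_congr_ae ?_)
    (lintegral_pairLaw_state hμ ρ n (hΦ.comp measurable_subtype_coe))
  filter_upwards [ae_pairLaw_quantumTrajectory hμ ρ n] with x hx
  exact congrArg Φ hx

end Chain

theorem theorem4p1 {d : ℕ} (hd : 2 ≤ d) (μ : Measure (Op d)) (hμ : IsStochastic μ)
    (hirr : IsIrreducibleMeasure μ) :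
    ∃ C lam : ℝ, 0 < C ∧ 0 < lam ∧ lam < 1 ∧
      ∀ ν : Measure (DensityMatrix d), IsProbabilityMeasure ν → ∀ n : ℕ,
        Integrable (fun p => darkDefect μ (quantumTrajectory n p)) (trajectoryLaw hμ ν) ∧
        ∫ p, darkDefect μ (quantumTrajectory n p) ∂(trajectoryLaw hμ ν) ≤ C * lam ^ n := by
  have := sigmaFinite_nonzeroPart hμ
  have hmom : ∫⁻ v, ENNReal.ofReal ‖v‖ ^ 2 ∂(nonzeroPart μ) < ⊤ := by
    rw [lintegral_nonzeroPart (by simp)]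
    simp_rw [fun v : Op d => ofReal_norm v]
    exact hμ.moment
  obtain ⟨r, h⟩ := exists_isMaximalDarkDim (μ := μ) hd
  obtain ⟨C, lam, hC, hl0, hl1, hbound⟩ := h.exists_evolve_rootDefect_le_pow
    (lintegral_enorm_sq_apply_nonzeroPart hμ) hmom hirr.nonzeroPart
  refine ⟨C, lam, hC, hl0, hl1, fun ν _ n => ?_⟩
  have hΦ : Measurable fun ρ : Op d => ENNReal.ofReal ‖darkDefect μ ρ‖ :=
    ENNReal.measurable_ofReal.comp h.measurable_darkDefect.norm
  have hle : ∫⁻ p, ENNReal.ofReal ‖darkDefect μ (quantumTrajectory n p)‖ ∂(trajectoryLaw hμ ν) ≤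
      ENNReal.ofReal (C * lam ^ n) := by
    rw [lintegral_quantumTrajectory hμ ν n hΦ]
    calc _ ≤ ∫⁻ _, ENNReal.ofReal (C * lam ^ n) ∂ν := by
          refine lintegral_mono fun ρ => le_trans (evolve_mono (fun ρ => ?_) n ρ) (hbound n ρ)
          refine ENNReal.ofReal_le_ofReal ?_
          rw [Real.norm_of_nonneg (h.darkDefect_nonneg ρ)]
          refine Real.le_sqrt_of_sq_le ?_
          have h0 := h.darkDefect_nonneg ρ
          have h1 := h.darkDefect_le_one ρ
          nlinarith
      _ = ENNReal.ofReal (C * lam ^ n) := by rw [lintegral_const, measure_univ, mul_one]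
  refine ⟨⟨(h.measurable_darkDefect.comp (measurable_quantumTrajectory n)).aestronglyMeasurable,
    ?_⟩, ?_⟩
  · rw [hasFiniteIntegral_iff_norm]
    exact hle.trans_lt ENNReal.ofReal_lt_top
  · refine (Real.le_norm_self _).trans ((norm_integral_le_lintegral_norm _).trans ?_)
    exact ENNReal.toReal_le_of_le_ofReal (by positivity) hle
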